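/- **Conventions.** Let $(M,\alpha)$ be a $(2n+1)$-dimensional co-oriented contact manifold: $\alpha$ is a smooth 1-form with $\alpha\wedge(d\alpha)^n\neq 0$ everywhere. Its Reeb vector field $Z$ is determined by $i_Z\alpha=1$, $i_Zd\alpha=0$. For a smooth function $f$ on $M$, the contact Hamiltonian vector field is $Y_f=fZ+\hat Y_f$, where $\hat Y_f$ is the unique section of $\ker\alpha$ with $-i_{\hat Y_f}d\alpha=df-Z(f)\,\alpha$. The Jacobi bracket is $[f,g]=Y_f(g)-g\,Z(f)$; in particular $[1,g]=Z(g)$. A submanifold $N$ with inclusion $j:N\to M$ is a contact submanifold of $(M,\alpha)$ if it is transverse to $\ker\alpha$ and $d(j^*\alpha)$ is nondegenerate on $\ker(j^*\alpha)$, so that $j^*\alpha$ is a contact form on $N$. **Theorem.** Let $G_1,\dots,G_{2k}$ be smooth functions on $M$, let $N=\{x\in M: G_1(x)=\dots=G_{2k}(x)=0\}$, with inclusion $j:N\to M$, and suppose that at every point of $N$ $$[1,G_j]=0\quad (j=1,\dots,2k),\qquad \det\big([G_j,G_i]\big)_{i,j}\neq 0 .$$ (a) $N$ is an embedded submanifold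 of $M$, of dimension $2(n-k)+1$ (with $k\le n$ if $N\neq\emptyset$), and $(N,j^*\alpha)$ is a contact submanifold of $(M,\alpha)$ whose Reeb vector field is the restriction of $Z$ to $N$. (b) Let $f$ be a smooth function on $M$. There are unique functions $\lambda_1,\dots,\lambda_{2k}$ on $N$ such that $W_f=Y_f-\sum_{i}\lambda_iY_{G_i}$ satisfies $$dG_j(W_f)=Y_f(G_j)-\sum_i\lambda_i\,Y_{G_i}(G_j)=0\quad\text{on } N,\qquad j=1,\dots,2k,$$ and for these functions $W_f$ is the contact Hamiltonian vector field of $f|_N$ on $(N,j^*\alpha)$. For every smooth function $g$ on $M$, the Jacobi bracket $[\cdot,\cdot]_N$ of $(N,j^*\alpha)$ satisfies, on $N$, $$[f|_N,g|_N]_N=[f,g]+\sum_{i,j}[G_i,g]\,A_{ij}\,[G_j,f],$$ where $(A_{ij})$ is the inverse of the matrix whose entry in row $i$ and column $j$ is $[G_j,G_i]$. In particular, if $Y_f$ is tangent to $N$ at all points of $N$, or $Y_g$ is, then $[f|_N,g|_N]_N=[f,g]$ on $N$. -/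

import Mathlib

open scoped Manifold ContDiff

namespace ContactDirac

noncomputable section

/-- A (not necessarily smooth) 1-form on a `d`-dimensional manifold without boundary:
a covector at every point. -/
abbrev OneForm (d : ℕ) (M : Type*) [TopologicalSpace M]
    [ChartedSpace (EuclideanSpace ℝ (Fin d)) M] : Type _ :=
  ∀ x : M, TangentSpace (𝓡 d) x →L[ℝ] ℝ

section Forms

variable {d : ℕ} {M : Type*} [TopologicalSpace M] [ChartedSpace (EuclideanSpace ℝ (Fin d)) M]

/-- Smoothness of a 1-form, as a section of the cotangent bundle. -/
def OneForm.IsSmooth [IsManifold (𝓡 d) ∞ M] (α : OneForm d M) : Prop :=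
  ContMDiff (𝓡 d) ((𝓡 d).prod 𝓘(ℝ, EuclideanSpace ℝ (Fin d) →L[ℝ] ℝ)) ∞
    (fun x : M => Bundle.TotalSpace.mk' (EuclideanSpace ℝ (Fin d) →L[ℝ] ℝ)
      (E := fun y : M => TangentSpace (𝓡 d) y →L[ℝ] Bundle.Trivial M ℝ y) x (α x))

/-- The expression of a 1-form in the preferred chart at `x₀`: its pullback by the inverse of that
chart, a 1-form on an open subset of Euclidean space (namely the target of the chart). -/
def OneForm.inChart (α : OneForm d M) (x₀ : M) (y : EuclideanSpace ℝ (Fin d)) :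
    EuclideanSpace ℝ (Fin d) [⋀^Fin 1]→L[ℝ] ℝ :=
  ContinuousAlternatingMap.ofSubsingleton ℝ (EuclideanSpace ℝ (Fin d)) ℝ (0 : Fin 1)
    ((α ((extChartAt (𝓡 d) x₀).symm y)).comp
      (mfderiv 𝓘(ℝ, EuclideanSpace ℝ (Fin d)) (𝓡 d) (extChartAt (𝓡 d) x₀).symm y))

/-- The exterior derivative `dα` of a 1-form, computed at `x` in the preferred chart at `x`
and transported back to the tangent space at `x` by the differential of the chart. The
normalization is `dα(X, Y) = X(α(Y)) - Y(α(X)) - α([X, Y])`. -/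
def OneForm.extDeriv (α : OneForm d M) (x : M) : TangentSpace (𝓡 d) x [⋀^Fin 2]→L[ℝ] ℝ :=
  (_root_.extDeriv (α.inChart x) (extChartAt (𝓡 d) x x)).compContinuousLinearMap
    (mfderiv (𝓡 d) 𝓘(ℝ, EuclideanSpace ℝ (Fin d)) (extChartAt (𝓡 d) x) x)

/-- The pullback `j^* α` of a 1-form by a map `j`. -/
def OneForm.pullback {e : ℕ} {N : Type*} [TopologicalSpace N]
    [ChartedSpace (EuclideanSpace ℝ (Fin e)) N] (j : N → M) (α : OneForm d M) : OneForm e N :=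
  fun x => (α (j x)).comp (mfderiv (𝓡 e) (𝓡 d) j x)

/-- The differential `df` of a function, as a 1-form. -/
def differential (f : M → ℝ) : OneForm d M := mvfderiv (𝓡 d) f

/-- Smooth real-valued functions. -/
def IsSmoothFun (d : ℕ) {M : Type*} [TopologicalSpace M]
    [ChartedSpace (EuclideanSpace ℝ (Fin d)) M] (f : M → ℝ) : Prop :=
  ContMDiff (𝓡 d) 𝓘(ℝ, ℝ) ∞ f

/-- `z` is the value at `x` of the Reeb vector field of `α`: `i_z α = 1` and `i_z dα = 0`. -/
def IsReebVector (α : OneForm d M) (x : M) (z : TangentSpace (𝓡 d) x) : Prop :=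
  α x z = 1 ∧ ∀ w : TangentSpace (𝓡 d) x, α.extDeriv x ![z, w] = 0

/-- The Reeb vector field `Z` of `α`; it is meaningful when `α` is a contact form, since then
exactly one vector at each point satisfies the defining conditions. -/
def reeb (α : OneForm d M) (x : M) : TangentSpace (𝓡 d) x :=
  Classical.epsilon (IsReebVector α x)

/-- The inverse of the restriction to the horizontal vectors (those in `ker α`) of
`v ↦ - i_v dα`; it is meaningful when `α` is a contact form and `η` is semi-basic, i.e. `η`
vanishes on the Reeb vector, since then there is exactly one such `v`. -/
def sharp (α : OneForm d M) (x : M) (η : TangentSpace (𝓡 d) x →L[ℝ] ℝ) :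
    TangentSpace (𝓡 d) x :=
  Classical.epsilon fun v => α x v = 0 ∧
    ∀ w : TangentSpace (𝓡 d) x, - α.extDeriv x ![v, w] = η w

/-- The contact Hamiltonian vector field `Y_f = f Z + α^♯(df - Z(f) α)`; here `df - Z(f) α` is
the semi-basic part of `df`. -/
def contactHam (α : OneForm d M) (f : M → ℝ) (x : M) : TangentSpace (𝓡 d) x :=
  f x • reeb α x + sharp α x (differential f x - differential f x (reeb α x) • α x)

/-- The Jacobi bracket `[f, g] = Y_f(g) - g Z(f)`. -/
def jacobiBracket (α : OneForm d M) (f g : M → ℝ) (x : M) : ℝ :=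
  differential g x (contactHam α f x) - g x * differential f x (reeb α x)

end Forms

section Contact

variable {n : ℕ} {M : Type*} [TopologicalSpace M]
  [ChartedSpace (EuclideanSpace ℝ (Fin (2 * n + 1))) M]

/-- The value of the top degree form `α ∧ (dα)^n` at `x` on the vectors `v 0, …, v (2 n)`. -/
def contactVolume (α : OneForm (2 * n + 1) M) (x : M)
    (v : Fin (2 * n + 1) → TangentSpace (𝓡 (2 * n + 1)) x) : ℝ :=
  (1 / 2 ^ n) * ∑ σ : Equiv.Perm (Fin (2 * n + 1)), ((Equiv.Perm.sign σ : ℤ) : ℝ) *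
    (α x (v (σ 0)) * ∏ i : Fin n, α.extDeriv x
      ![v (σ ⟨2 * (i : ℕ) + 1, by omega⟩), v (σ ⟨2 * (i : ℕ) + 2, by omega⟩)])

/-- `α` is a contact form: a smooth 1-form such that `α ∧ (dα)^n` vanishes nowhere. -/
def IsContactForm [IsManifold (𝓡 (2 * n + 1)) ∞ M] (α : OneForm (2 * n + 1) M) : Prop :=
  α.IsSmooth ∧ ∀ x : M, ∃ v, contactVolume α x v ≠ 0

end Contact

/-- `(N, j^* α)` is a co-oriented contact submanifold of `(M, α)`: `j` is a smooth embedding,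
`N` is transverse to `ker α`, `d(j^* α)` is nondegenerate on `ker (j^* α)`, and `j^* α` is a
contact form on `N`. -/
structure IsContactSubmanifold {d m : ℕ} {M N : Type*} [TopologicalSpace M] [TopologicalSpace N]
    [ChartedSpace (EuclideanSpace ℝ (Fin d)) M]
    [ChartedSpace (EuclideanSpace ℝ (Fin (2 * m + 1))) N]
    [IsManifold (𝓡 (2 * m + 1)) ∞ N] (α : OneForm d M) (j : N → M) : Prop where
  isSmoothEmbedding : Manifold.IsSmoothEmbedding (𝓡 (2 * m + 1)) (𝓡 d) ∞ j
  transverse : ∀ x : N, (mfderiv (𝓡 (2 * m + 1)) (𝓡 d) j x).range ⊔ (α (j x)).ker = ⊤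
  nondegenerate : ∀ (x : N) (v : TangentSpace (𝓡 (2 * m + 1)) x),
    (α.pullback j : OneForm (2 * m + 1) N) x v = 0 →
    (∀ w : TangentSpace (𝓡 (2 * m + 1)) x, (α.pullback j : OneForm (2 * m + 1) N) x w = 0 →
      (α.pullback j : OneForm (2 * m + 1) N).extDeriv x ![v, w] = 0) → v = 0
  isContactForm : IsContactForm (α.pullback j : OneForm (2 * m + 1) N)

/-- The common zero set of a family of functions. -/
def zeroLocus {ι M : Type*} (G : ι → M → ℝ) : Set M := {x | ∀ i, G i x = 0}

/-- The inclusion of the common zero set of a family of functions. -/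
abbrev incl {ι M : Type*} (G : ι → M → ℝ) : zeroLocus G → M := Subtype.val

section Constraints

variable {d : ℕ} {M : Type*} [TopologicalSpace M] [ChartedSpace (EuclideanSpace ℝ (Fin d)) M]
  {ι : Type*} [Fintype ι]

/-- The matrix of brackets of the constraints, with `[G_j, G_i](x)` in row `i`, column `j`. -/
def bracketMatrix (α : OneForm d M) (G : ι → M → ℝ) (x : M) : Matrix ι ι ℝ :=
  Matrix.of fun i j => jacobiBracket α (G j) (G i) x

/-- The vector `W_f = Y_f - ∑ i, c_i Y_{G_i}` at `x`. -/
def correctedHam (α : OneForm d M) (G : ι → M → ℝ) (f : M → ℝ) (c : ι → ℝ) (x : M) :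
    TangentSpace (𝓡 d) x :=
  contactHam α f x - ∑ i, c i • contactHam α (G i) x

/-- The functions `c_i` on `N = {G = 0}` solve the multiplier equations `dG_j(W_f) = 0`. -/
def IsMultiplier (α : OneForm d M) (G : ι → M → ℝ) (f : M → ℝ) (c : ι → zeroLocus G → ℝ) : Prop :=
  ∀ (x : zeroLocus G) (j : ι),
    differential (G j) (x : M) (correctedHam α G f (fun i => c i x) x) = 0

end Constraints

end

end ContactDirac

open ContactDirac

/-!
Write `ω = dα`. The contact condition at a point says that no nonzero vector of `ker α` is
`ω`-orthogonal to the whole tangent space: `α ∧ ω ^ n` vanishes on every basis containing such a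
vector, and is positive on the Reeb vector followed by a symplectic basis of `ker α`.

Along `N` the condition `[1, G j] = dG j (Z) = 0` makes `Z` tangent to `N` and gives
`ω (Y_{G i}, ·) = -dG i`, so `[G i, G j] = dG j (Y_{G i}) = ω (Y_{G i}, Y_{G j})` up to sign. As
this matrix is invertible, the `dG i` are independent, hence `N` is cut out by slice charts with
`TN = ⋂ i, ker (dG i)`, and the tangent space of `M` is the direct sum of `TN` and the span of the
`Y_{G i}`, which are `ω`-orthogonal to each other. So `ω` stays nondegenerate on `TN ∩ ker α`, and
the component of `Y_f` along `TN`, which is `W_f`, satisfies the equations of the Hamiltonian field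
of `f` on `N`. Solving for the multipliers gives `λ i = -∑ j, A i j * [G j, f]`, and the bracket
formula follows from `[f, g]_N = dg (W_f) - g * df (Z)`.
-/

namespace ContactDirac

noncomputable section

section LinearAlgebra

open Module

section CommRing

variable {R V ι : Type*} [CommRing R] [AddCommGroup V] [Module R V] [Fintype ι] [DecidableEq ι]

theorem prod_bilin_update (B : LinearMap.BilinForm R V) (v : Option (ι × Fin 2) → V) (i : ι)
    (b : Fin 2) (x : V) :
    ∏ l, B (Function.update v (some (i, b)) x (some (l, 0)))
        (Function.update v (some (i, b)) x (some (l, 1))) =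
      (∏ l ∈ Finset.univ.erase i, B (v (some (l, 0))) (v (some (l, 1)))) *
        B (if b = 0 then x else v (some (i, 0))) (if b = 1 then x else v (some (i, 1))) := by
  rw [← Finset.prod_erase_mul _ _ (Finset.mem_univ i)]
  congr 1
  · refine Finset.prod_congr rfl fun l hl => ?_
    simp [Finset.ne_of_mem_erase hl]
  · simp [Function.update_apply, eq_comm]

/-- The product `a ⊗ B ⊗ ⋯ ⊗ B` with one factor `B` for each element of `ι`, of which `a ∧ B^ι` is
the antisymmetrization. The slot of `a` is `none`, those of the factor `i` are `(i, 0)` and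
`(i, 1)`. -/
def contactProduct (a : Dual R V) (B : LinearMap.BilinForm R V) :
    MultilinearMap R (fun _ : Option (ι × Fin 2) => V) R :=
  MultilinearMap.mk' (fun v => a (v none) * ∏ i, B (v (some (i, 0))) (v (some (i, 1))))
    (by
      rintro v (_ | ⟨i, b⟩) x y
      · simp [add_mul]
      · simp only [prod_bilin_update]
        fin_cases b <;> simp [mul_add])
    (by
      rintro v (_ | ⟨i, b⟩) c x
      · simp [mul_assoc]
      · simp only [prod_bilin_update]
        fin_cases b <;> simp [mul_left_comm])

theorem contactProduct_apply (a : Dual R V) (B : LinearMap.BilinForm R V)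
    (v : Option (ι × Fin 2) → V) :
    contactProduct a B v = a (v none) * ∏ i, B (v (some (i, 0))) (v (some (i, 1))) :=
  rfl

/-- The top degree form `a ∧ B ∧ ⋯ ∧ B` with one factor `B` for each element of `ι`, multiplied by
`2 ^ card ι`. -/
def contactTopForm (a : Dual R V) (B : LinearMap.BilinForm R V) :
    V [⋀^Option (ι × Fin 2)]→ₗ[R] R :=
  MultilinearMap.alternatization (contactProduct a B)

theorem contactTopForm_apply (a : Dual R V) (B : LinearMap.BilinForm R V)
    (v : Option (ι × Fin 2) → V) :
    contactTopForm a B v = ∑ σ : Equiv.Perm (Option (ι × Fin 2)),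
      ((Equiv.Perm.sign σ : ℤ) : R) * contactProduct a B (v ∘ σ) := by
  rw [contactTopForm, MultilinearMap.alternatization_apply]
  refine Finset.sum_congr rfl fun σ _ => ?_
  rw [Units.smul_def, zsmul_eq_mul]
  rfl

/-- The pair of a linear form `a` and a bilinear form `B` is nondegenerate in the sense of contact
geometry: no nonzero vector is annihilated by both `a` and `B`. -/
def IsContactPair (a : Dual R V) (B : LinearMap.BilinForm R V) : Prop :=
  ∀ z, a z = 0 → (∀ w, B z w = 0) → z = 0

variable {a : Dual R V} {B : LinearMap.BilinForm R V}

theorem contactProduct_eq_zero (hB : B.IsAlt) {z : V} (haz : a z = 0) (hBz : ∀ w, B z w = 0)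
    {v : Option (ι × Fin 2) → V} (hv : z ∈ Set.range v) : contactProduct a B v = 0 := by
  rw [contactProduct_apply]
  obtain ⟨_ | ⟨i, b⟩, rfl⟩ := hv
  · rw [haz, zero_mul]
  · rw [Finset.prod_eq_zero (Finset.mem_univ i), mul_zero]
    fin_cases b
    · exact hBz _
    · exact hB.isRefl.eq_zero (hBz _)

theorem IsContactPair.ext (h : IsContactPair a B) {v w : V} (ha : a v = a w)
    (hB : ∀ u, B v u = B w u) : v = w :=
  sub_eq_zero.mp (h _ (by simp [ha]) fun u => by simp [hB])

end CommRing

section Field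

variable {K V ι : Type*} [Field K] [AddCommGroup V] [Module K V]

section Finite

variable [Finite ι]

theorem exists_basis_mem_range [FiniteDimensional K V] (hV : finrank K V = Nat.card ι)
    {z : V} (hz : z ≠ 0) : ∃ b : Basis ι K V, z ∈ Set.range b := by
  have hli : LinearIndepOn K id {z} := by simpa using hz
  let b := Basis.extend hli
  have e := (Finite.card_eq.mp ((finrank_eq_nat_card_basis b).symm.trans hV)).some
  refine ⟨b.reindex e, ?_⟩
  rw [Basis.range_reindex, Basis.range_extend]
  exact Basis.subset_extend hli rfl

theorem exists_perm_apply_eq_of_fst_eq {κ : Type*} [Finite κ] [Nonempty κ]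
    (ρ : Equiv.Perm (ι × κ)) (h : ∀ i k l, (ρ (i, k)).1 = (ρ (i, l)).1) :
    ∃ (π : Equiv.Perm ι) (q : ι → Equiv.Perm κ), ∀ i k, ρ (i, k) = (π i, q i k) := by
  obtain ⟨k₀⟩ := ‹Nonempty κ›
  have hπ : Function.Surjective fun i => (ρ (i, k₀)).1 := fun j =>
    ⟨(ρ.symm (j, k₀)).1, (h _ _ _).trans (congrArg Prod.fst (ρ.apply_symm_apply (j, k₀)))⟩
  have hq : ∀ i, Function.Injective fun k => (ρ (i, k)).2 := fun i k l hkl =>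
    (Prod.ext_iff.mp (ρ.injective (Prod.ext (h i k l) hkl))).2
  exact ⟨Equiv.ofBijective _ (Finite.surjective_iff_bijective.mp hπ),
    fun i => Equiv.ofBijective _ (Finite.injective_iff_bijective.mp (hq i)),
    fun i k => Prod.ext (h i k k₀) rfl⟩

end Finite

variable [Fintype ι] [DecidableEq ι] {a : Dual K V} {B : LinearMap.BilinForm K V}

theorem IsContactPair.of_contactTopForm_ne_zero [FiniteDimensional K V] (hB : B.IsAlt)
    (hV : finrank K V = Nat.card (Option (ι × Fin 2)))
    (h : (contactTopForm a B : V [⋀^Option (ι × Fin 2)]→ₗ[K] K) ≠ 0) : IsContactPair a B := by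
  intro z haz hBz
  by_contra hz
  obtain ⟨b, hb⟩ := exists_basis_mem_range hV hz
  refine (AlternatingMap.map_basis_ne_zero_iff b _).mpr h ?_
  rw [contactTopForm_apply]
  refine Finset.sum_eq_zero fun σ _ => ?_
  rw [contactProduct_eq_zero hB haz hBz (by rwa [σ.surjective.range_comp]), mul_zero]

theorem exists_apply_sum_smul_eq {D : ι → Dual K V} {Y : ι → V}
    (hdet : (Matrix.of fun i j => D i (Y j)).det ≠ 0) (u : ι → K) :
    ∃ c : ι → K, ∀ i, D i (∑ j, c j • Y j) = u i := by
  obtain ⟨c, hc⟩ := Matrix.mulVec_surjective_iff_isUnit.mpr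
    ((Matrix.isUnit_iff_isUnit_det _).mpr hdet.isUnit) u
  refine ⟨c, fun i => ?_⟩
  rw [← hc]
  simp [Matrix.mulVec, dotProduct, mul_comm]

theorem IsContactPair.eq_zero_of_iInf_ker (h : IsContactPair a B) (hB : B.IsAlt)
    {D : ι → Dual K V} {Y : ι → V} (hY : ∀ i w, B (Y i) w = -D i w)
    (hdet : (Matrix.of fun i j => D i (Y j)).det ≠ 0) {v : V} (hv : ∀ i, D i v = 0)
    (hav : a v = 0) (hBv : ∀ w, (∀ i, D i w = 0) → B v w = 0) : v = 0 := by
  refine h v hav fun w => ?_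
  obtain ⟨c, hc⟩ := exists_apply_sum_smul_eq hdet fun i => D i w
  have hw : B v (w - ∑ j, c j • Y j) = 0 := hBv _ fun i => by rw [map_sub, hc, sub_self]
  have hvY : ∀ j, B v (Y j) = 0 := fun j => hB.isRefl.eq_zero (by rw [hY, hv, neg_zero])
  simpa [hvY] using hw

theorem not_separatingLeft_of_isAlt_of_odd [NeZero (2 : K)] [FiniteDimensional K V]
    (hB : B.IsAlt) (hV : Odd (finrank K V)) : ¬ B.SeparatingLeft := by
  let b := finBasis K V
  let A := LinearMap.toMatrix₂ b b B
  have hA : A.transpose = -A := by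
    ext i j
    simp [A, LinearMap.toMatrix₂_apply, hB.neg_eq]
  have hdet : A.det = -A.det := by
    simpa [Matrix.det_neg, hV.neg_one_pow] using congrArg Matrix.det hA
  rw [LinearMap.separatingLeft_iff_det_ne_zero b, not_not]
  refine (mul_eq_zero_iff_left two_ne_zero).mp ?_
  rw [two_mul]
  exact eq_neg_iff_add_eq_zero.mp hdet

namespace IsContactPair

theorem exists_reeb [NeZero (2 : K)] [FiniteDimensional K V] (h : IsContactPair a B)
    (hB : B.IsAlt) (hV : Odd (finrank K V)) : ∃ z, a z = 1 ∧ ∀ w, B z w = 0 := by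
  obtain ⟨z, hBz, hz⟩ : ∃ z, (∀ w, B z w = 0) ∧ z ≠ 0 := by
    simpa [LinearMap.SeparatingLeft] using not_separatingLeft_of_isAlt_of_odd hB hV
  have haz : a z ≠ 0 := fun haz => hz (h z haz hBz)
  exact ⟨(a z)⁻¹ • z, by simp [haz], fun w => by simp [hBz]⟩

theorem separatingLeft_restrict_ker (h : IsContactPair a B) (hB : B.IsAlt) {z : V}
    (haz : a z = 1) (hBz : ∀ w, B z w = 0) : (B.restrict a.ker).SeparatingLeft := by
  rintro ⟨v, hv⟩ hBv
  refine Subtype.ext (h v hv fun w => ?_)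
  have hw : B v (w - a w • z) = 0 := hBv ⟨w - a w • z, by simp [haz]⟩
  simpa [hB.isRefl.eq_zero (hBz v)] using hw

theorem exists_sharp [FiniteDimensional K V] (h : IsContactPair a B) (hB : B.IsAlt) {z : V}
    (haz : a z = 1) (hBz : ∀ w, B z w = 0) {η : Dual K V} (hη : η z = 0) :
    ∃ v, a v = 0 ∧ ∀ w, -B v w = η w := by
  let L : V →ₗ[K] Dual K V := a.smulRight a - B
  have hLz : ∀ v, L v z = a v := fun v => by simp [L, haz, hB.isRefl.eq_zero (hBz v)]
  have hL : Function.Injective L := by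
    refine (injective_iff_map_eq_zero L).mpr fun v hv => ?_
    have hav : a v = 0 := by rw [← hLz, hv, LinearMap.zero_apply]
    exact h v hav fun w => by simpa [L, hav] using LinearMap.congr_fun hv w
  obtain ⟨v, hv⟩ := (LinearMap.injective_iff_surjective_of_finrank_eq_finrank
    (Subspace.dual_finrank_eq (K := K) (V := V)).symm).mp hL η
  have hav : a v = 0 := by rw [← hLz, hv, hη]
  exact ⟨v, hav, fun w => by simpa [L, hav] using LinearMap.congr_fun hv w⟩

end IsContactPair

/-- The standard symplectic form on the vectors of a symplectic basis indexed by `ι × Fin 2`, whose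
pairs of conjugate vectors are indexed by `ι`. -/
def symplecticSign (p q : ι × Fin 2) : ℤ :=
  if p.1 = q.1 then ((q.2 : ℕ) : ℤ) - (p.2 : ℕ) else 0

/-- A symplectic family for `B`, with pairs of conjugate vectors indexed by `ι`. -/
def IsSymplecticFamily (B : LinearMap.BilinForm K V) (u : ι × Fin 2 → V) : Prop :=
  ∀ p q, B (u p) (u q) = symplecticSign p q

theorem exists_hyperbolic_pair_orthogonal [FiniteDimensional K V] (hB : B.IsAlt)
    (hsep : B.SeparatingLeft)
    {u : ι × Fin 2 → V} (hu : IsSymplecticFamily B u) (hcard : 2 * Fintype.card ι < finrank K V) :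
    ∃ x y, B x y = 1 ∧ ∀ p, B (u p) x = 0 ∧ B (u p) y = 0 := by
  obtain ⟨x, hx, hx0⟩ := Submodule.ne_bot_iff _ |>.mp
    ((LinearMap.pi fun p => B (u p)).ker_ne_bot_of_finrank_lt (by simpa [mul_comm] using hcard))
  have hux : ∀ p, B (u p) x = 0 := by simpa [funext_iff] using hx
  obtain ⟨y, hy⟩ : ∃ y, B x y ≠ 0 := by
    by_contra! hBx
    exact hx0 (hsep x hBx)
  let y' := y - ∑ i, (B (u (i, 0)) y • u (i, 1) - B (u (i, 1)) y • u (i, 0))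
  have hxy' : B x y' = B x y := by simp [y', fun p => hB.isRefl.eq_zero (hux p)]
  have huy' : ∀ p, B (u p) y' = 0 := by
    rintro ⟨i, b⟩
    fin_cases b <;> simp [y', hu _ _, symplecticSign]
  exact ⟨x, (B x y)⁻¹ • y', by simp [hxy', hy], fun p => ⟨hux p, by simp [huy']⟩⟩

theorem exists_isSymplecticFamily [FiniteDimensional K V] (hB : B.IsAlt) (hsep : B.SeparatingLeft)
    {n : ℕ} (hn : 2 * n ≤ finrank K V) : ∃ u : Fin n × Fin 2 → V, IsSymplecticFamily B u := by
  induction n with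
  | zero => exact ⟨fun p => p.1.elim0, fun p => p.1.elim0⟩
  | succ n ih =>
    obtain ⟨u, hu⟩ := ih (by lia)
    obtain ⟨x, y, hxy, hup⟩ := exists_hyperbolic_pair_orthogonal hB hsep hu (by simp; lia)
    have hpu : ∀ p, B x (u p) = 0 ∧ B y (u p) = 0 := fun p =>
      ⟨hB.isRefl.eq_zero (hup p).1, hB.isRefl.eq_zero (hup p).2⟩
    have hyx : B y x = -1 := by rw [← hB.neg_eq, hxy]
    refine ⟨fun p => Fin.cases (![x, y] p.2) (fun i => u (i, p.2)) p.1, ?_⟩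
    rintro ⟨i, b⟩ ⟨l, c⟩
    cases i using Fin.cases <;> cases l using Fin.cases
    · fin_cases b <;> fin_cases c <;> simp [symplecticSign, hxy, hyx, hB.self_eq_zero]
    · fin_cases b <;> simp [symplecticSign, hpu, (Fin.succ_ne_zero _).symm]
    · fin_cases c <;> simp [symplecticSign, hup]
    · simp [hu _ _, symplecticSign]

theorem sign_eq_prod_sub_of_apply_eq {ρ : Equiv.Perm (ι × Fin 2)} {π : Equiv.Perm ι}
    {q : ι → Equiv.Perm (Fin 2)} (h : ∀ i b, ρ (i, b) = (π i, q i b)) :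
    (Equiv.Perm.sign ρ : ℤ) = ∏ i, (((q i 1 : ℕ) : ℤ) - (q i 0 : ℕ)) := by
  have hρ : ρ = Equiv.prodCongrLeft (fun _ => π) * Equiv.prodCongrRight q :=
    Equiv.ext fun p => h p.1 p.2
  have hsign : ∀ τ : Equiv.Perm (Fin 2),
      (Equiv.Perm.sign τ : ℤ) = ((τ 1 : ℕ) : ℤ) - (τ 0 : ℕ) := by decide
  rw [hρ, map_mul, Equiv.Perm.sign_prodCongrLeft, Equiv.Perm.sign_prodCongrRight,
    Fin.prod_univ_two, Int.units_mul_self, one_mul, Units.coe_prod]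
  exact Finset.prod_congr rfl fun i _ => hsign (q i)

theorem sign_mul_prod_symplecticSign_nonneg (ρ : Equiv.Perm (ι × Fin 2)) :
    0 ≤ (Equiv.Perm.sign ρ : ℤ) * ∏ i, symplecticSign (ρ (i, 0)) (ρ (i, 1)) := by
  by_cases hρ : ∀ i, (ρ (i, 0)).1 = (ρ (i, 1)).1
  · obtain ⟨π, q, hπq⟩ := exists_perm_apply_eq_of_fst_eq ρ fun i k l => by
      fin_cases k <;> fin_cases l <;> simp [hρ]
    rw [sign_eq_prod_sub_of_apply_eq hπq]
    simp only [symplecticSign, hπq, if_true]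
    exact mul_self_nonneg _
  · obtain ⟨i, hi⟩ := not_forall.mp hρ
    rw [Finset.prod_eq_zero (Finset.mem_univ i) (if_neg hi), mul_zero]

section Ordered

variable [LinearOrder K] [IsStrictOrderedRing K]

theorem sign_mul_contactProduct_nonneg {z : V} (haz : a z = 1) {u : ι × Fin 2 → V}
    (hau : ∀ p, a (u p) = 0) (hu : IsSymplecticFamily B u)
    (τ : Equiv.Perm (Option (ι × Fin 2))) :
    0 ≤ ((Equiv.Perm.sign τ : ℤ) : K) * contactProduct a B ((fun p => p.elim z u) ∘ τ) := by
  rw [contactProduct_apply]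
  cases hτ : τ none with
  | some p => simp [hτ, hau]
  | none =>
    obtain ⟨ρ, rfl⟩ : ∃ ρ, τ = Equiv.optionCongr ρ :=
      ⟨Equiv.removeNone τ, by rw [map_equiv_removeNone, hτ, Equiv.swap_self]; rfl⟩
    simpa [haz, hu _ _] using Int.cast_nonneg (R := K) (sign_mul_prod_symplecticSign_nonneg ρ)

theorem contactTopForm_pos {z : V} (haz : a z = 1) {u : ι × Fin 2 → V} (hau : ∀ p, a (u p) = 0)
    (hu : IsSymplecticFamily B u) :
    0 < (contactTopForm a B : V [⋀^Option (ι × Fin 2)]→ₗ[K] K) (fun p => p.elim z u) := by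
  rw [contactTopForm_apply]
  refine Finset.sum_pos' (fun τ _ => sign_mul_contactProduct_nonneg haz hau hu τ)
    ⟨1, Finset.mem_univ _, ?_⟩
  simp [contactProduct_apply, haz, hu _ _, symplecticSign]

theorem IsContactPair.contactTopForm_ne_zero [FiniteDimensional K V] (h : IsContactPair a B)
    (hB : B.IsAlt) {n : ℕ} (hV : finrank K V = 2 * n + 1) :
    (contactTopForm a B : V [⋀^Option (Fin n × Fin 2)]→ₗ[K] K) ≠ 0 := by
  obtain ⟨z, haz, hBz⟩ := h.exists_reeb hB (hV ▸ odd_two_mul_add_one n)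
  have hker : finrank K a.ker = 2 * n := by
    have ha : a ≠ 0 := fun ha => by simp [ha] at haz
    have := Dual.finrank_ker_add_one_of_ne_zero ha
    lia
  obtain ⟨u, hu⟩ := exists_isSymplecticFamily (B := B.restrict a.ker) (fun v => hB v)
    (h.separatingLeft_restrict_ker hB haz hBz) hker.ge
  intro h0
  have := contactTopForm_pos haz (fun p => (u p).2) hu
  simp [h0] at this

end Ordered

end Field

end LinearAlgebra

section Forms

open Topology

variable {d : ℕ} {M : Type*} [TopologicalSpace M] [ChartedSpace (EuclideanSpace ℝ (Fin d)) M]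

theorem OneForm.apply_congr (α : OneForm d M) {x y : M} (h : x = y)
    {v w : EuclideanSpace ℝ (Fin d)} (hvw : v = w) :
    (α x : EuclideanSpace ℝ (Fin d) →L[ℝ] ℝ) v = (α y : EuclideanSpace ℝ (Fin d) →L[ℝ] ℝ) w := by
  subst h hvw
  rfl

variable [IsManifold (𝓡 d) ∞ M]

theorem mfderiv_extChartAt_self (x : M) :
    mfderiv (𝓡 d) 𝓘(ℝ, EuclideanSpace ℝ (Fin d)) (extChartAt (𝓡 d) x) x =
      ContinuousLinearMap.id ℝ (EuclideanSpace ℝ (Fin d)) := by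
  have h := mfderiv_chartAt_eq_tangentCoordChange (I := 𝓡 d) (mem_chart_source _ x)
  exact h.trans (ContinuousLinearMap.ext fun v => tangentCoordChange_self (mem_extChartAt_source x))

/-- A 1-form read in the preferred trivialization of the tangent bundle at `x₀`. -/
def OneForm.inTrivialization (α : OneForm d M) (x₀ x : M) : EuclideanSpace ℝ (Fin d) →L[ℝ] ℝ :=
  (α x).comp ((trivializationAt (EuclideanSpace ℝ (Fin d)) (TangentSpace (𝓡 d)) x₀).symmL ℝ x)

theorem OneForm.isSmooth_iff (α : OneForm d M) :
    α.IsSmooth ↔ ∀ x₀, ContMDiffAt (𝓡 d) 𝓘(ℝ, EuclideanSpace ℝ (Fin d) →L[ℝ] ℝ) ∞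
      (α.inTrivialization x₀) x₀ := by
  refine forall_congr' fun x₀ => ?_
  rw [contMDiffAt_hom_bundle]
  refine (and_iff_right contMDiffAt_id).trans ?_
  refine Iff.of_eq (congrArg (fun F => ContMDiffAt _ _ _ F x₀) (funext fun x => ?_))
  ext v
  simp [ContinuousLinearMap.inCoordinates, OneForm.inTrivialization]

theorem OneForm.inChart_eq (α : OneForm d M) (x₀ : M) {y : EuclideanSpace ℝ (Fin d)}
    (hy : y ∈ (extChartAt (𝓡 d) x₀).target) :
    α.inChart x₀ y = ContinuousAlternatingMap.ofSubsingleton ℝ (EuclideanSpace ℝ (Fin d)) ℝ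
      (0 : Fin 1) (α.inTrivialization x₀ ((extChartAt (𝓡 d) x₀).symm y)) := by
  have hx : (extChartAt (𝓡 d) x₀).symm y ∈ (chartAt (EuclideanSpace ℝ (Fin d)) x₀).source := by
    rw [← extChartAt_source (𝓡 d)]
    exact (extChartAt (𝓡 d) x₀).map_target hy
  have h := TangentBundle.symmL_trivializationAt (I := 𝓡 d) hx
  rw [(extChartAt (𝓡 d) x₀).right_inv hy, ModelWithCorners.range_eq_univ, mfderivWithin_univ] at h
  rw [OneForm.inChart, OneForm.inTrivialization, h]

theorem OneForm.IsSmooth.differentiableAt_inChart {α : OneForm d M} (hα : α.IsSmooth) (x₀ : M) :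
    DifferentiableAt ℝ (α.inChart x₀) (extChartAt (𝓡 d) x₀ x₀) := by
  have hsymm : ContMDiffAt 𝓘(ℝ, EuclideanSpace ℝ (Fin d)) (𝓡 d) ∞ (extChartAt (𝓡 d) x₀).symm
      (extChartAt (𝓡 d) x₀ x₀) :=
    (contMDiffOn_extChartAt_symm x₀).contMDiffAt (extChartAt_target_mem_nhds x₀)
  have hcomp := ContMDiffAt.comp_of_eq (α.isSmooth_iff.mp hα x₀) hsymm (extChartAt_to_inv x₀)
  have hdiff := (ContinuousAlternatingMap.ofSubsingletonLIE (𝕜 := ℝ)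
    (E := EuclideanSpace ℝ (Fin d)) (F := ℝ) (0 : Fin 1)).differentiable.differentiableAt.comp _
      ((contMDiffAt_iff_contDiffAt.mp hcomp).differentiableAt (by simp))
  refine hdiff.congr_of_eventuallyEq ?_
  filter_upwards [extChartAt_target_mem_nhds (I := 𝓡 d) x₀] with y hy
  exact α.inChart_eq x₀ hy

variable {e : ℕ} {N : Type*} [TopologicalSpace N] [ChartedSpace (EuclideanSpace ℝ (Fin e)) N]
  [IsManifold (𝓡 e) ∞ N]

theorem OneForm.IsSmooth.pullback {α : OneForm d M} (hα : α.IsSmooth) {j : N → M}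
    (hj : ContMDiff (𝓡 e) (𝓡 d) ∞ j) : (α.pullback j : OneForm e N).IsSmooth := by
  rw [OneForm.isSmooth_iff]
  intro p
  have hαj : ContMDiffAt (𝓡 e) 𝓘(ℝ, EuclideanSpace ℝ (Fin d) →L[ℝ] ℝ) ∞
      (fun x => α.inTrivialization (j p) (j x)) p :=
    ContMDiffAt.comp p (α.isSmooth_iff.mp hα (j p)) (hj p)
  have hdj := ContMDiffAt.mfderiv_const (m := ∞) (hj p) (by simp)
  refine (hαj.clm_comp hdj).congr_of_eventuallyEq ?_
  have hbase := hj.continuous.continuousAt.preimage_mem_nhds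
    ((trivializationAt (EuclideanSpace ℝ (Fin d)) (TangentSpace (𝓡 d)) (j p)).open_baseSet.mem_nhds
      (FiberBundle.mem_baseSet_trivializationAt' (j p)))
  filter_upwards [hbase] with x hx
  ext v
  simp only [inTangentCoordinates, ContinuousLinearMap.inCoordinates, OneForm.inTrivialization,
    OneForm.pullback, ContinuousLinearMap.comp_apply, id_eq]
  rw [Bundle.Trivialization.symmL_continuousLinearMapAt _ hx]

theorem mfderiv_extChartAt_symm_comp_mfderiv_writtenInExtChartAt {j : N → M} {p : N}
    {y : EuclideanSpace ℝ (Fin e)} (hy : y ∈ (extChartAt (𝓡 e) p).target)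
    (hjy : j ((extChartAt (𝓡 e) p).symm y) ∈ (extChartAt (𝓡 d) (j p)).source)
    (hj : MDifferentiableAt (𝓡 e) (𝓡 d) j ((extChartAt (𝓡 e) p).symm y)) :
    (mfderiv 𝓘(ℝ, EuclideanSpace ℝ (Fin d)) (𝓡 d) (extChartAt (𝓡 d) (j p)).symm
        (writtenInExtChartAt (𝓡 e) (𝓡 d) p j y)).comp
      (mfderiv 𝓘(ℝ, EuclideanSpace ℝ (Fin e)) 𝓘(ℝ, EuclideanSpace ℝ (Fin d))
        (writtenInExtChartAt (𝓡 e) (𝓡 d) p j) y) =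
    (mfderiv (𝓡 e) (𝓡 d) j ((extChartAt (𝓡 e) p).symm y)).comp
      (mfderiv 𝓘(ℝ, EuclideanSpace ℝ (Fin e)) (𝓡 e) (extChartAt (𝓡 e) p).symm y) := by
  set φ := extChartAt (𝓡 d) (j p)
  set ψ := extChartAt (𝓡 e) p
  have hψy : MDifferentiableAt 𝓘(ℝ, EuclideanSpace ℝ (Fin e)) (𝓡 e) ψ.symm y :=
    ((contMDiffOn_extChartAt_symm (n := ∞) p).contMDiffAt
      (extChartAt_target_mem_nhds' hy)).mdifferentiableAt (by simp)
  have hφj : MDifferentiableAt (𝓡 d) 𝓘(ℝ, EuclideanSpace ℝ (Fin d)) φ (j (ψ.symm y)) :=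
    mdifferentiableAt_extChartAt (by rwa [← extChartAt_source (𝓡 d)])
  have hφy : MDifferentiableAt 𝓘(ℝ, EuclideanSpace ℝ (Fin d)) (𝓡 d) φ.symm (φ (j (ψ.symm y))) :=
    ((contMDiffOn_extChartAt_symm (n := ∞) (j p)).contMDiffAt
      (extChartAt_target_mem_nhds' (φ.map_source hjy))).mdifferentiableAt (by simp)
  have hcancel : φ.symm ∘ φ ∘ j ∘ ψ.symm =ᶠ[𝓝 y] j ∘ ψ.symm := by
    filter_upwards [(hj.comp y hψy).continuousAt.preimage_mem_nhds
      ((isOpen_extChartAt_source (j p)).mem_nhds hjy)] with z hz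
    exact φ.left_inv hz
  exact (mfderiv_comp y hφy (hφj.comp y (hj.comp y hψy))).symm.trans
    (hcancel.mfderiv_eq.trans (mfderiv_comp y hj hψy))

theorem OneForm.inChart_pullback_eventuallyEq (α : OneForm d M) {j : N → M} {p : N}
    (hj : ContMDiffAt (𝓡 e) (𝓡 d) 1 j p) :
    (α.pullback j : OneForm e N).inChart p =ᶠ[𝓝 (extChartAt (𝓡 e) p p)]
      fun y => (α.inChart (j p) (writtenInExtChartAt (𝓡 e) (𝓡 d) p j y)).compContinuousLinearMap
        (fderiv ℝ (writtenInExtChartAt (𝓡 e) (𝓡 d) p j) y) := by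
  have hmdiff : ∀ᶠ x in 𝓝 p, MDifferentiableAt (𝓡 e) (𝓡 d) j x :=
    ((contMDiffAt_iff_contMDiffAt_nhds (by simp)).mp hj).mono
      fun x hx => hx.mdifferentiableAt one_ne_zero
  have hsource : ∀ᶠ x in 𝓝 p, j x ∈ (extChartAt (𝓡 d) (j p)).source :=
    hj.continuousAt.eventually (extChartAt_source_mem_nhds (j p))
  have hsymm : Filter.Tendsto (extChartAt (𝓡 e) p).symm (𝓝 (extChartAt (𝓡 e) p p)) (𝓝 p) := by
    simpa [ContinuousAt] using continuousAt_extChartAt_symm (I := 𝓡 e) p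
  filter_upwards [extChartAt_target_mem_nhds (I := 𝓡 e) p, hsymm.eventually hmdiff,
    hsymm.eventually hsource] with y hy hjy hjy'
  ext u
  have hcomp := mfderiv_extChartAt_symm_comp_mfderiv_writtenInExtChartAt hy hjy' hjy
  rw [mfderiv_eq_fderiv] at hcomp
  exact (α.apply_congr ((extChartAt (𝓡 d) (j p)).left_inv hjy')
    (congrArg (fun L => L (u 0)) hcomp)).symm

theorem OneForm.extDeriv_pullback {α : OneForm d M} {j : N → M} {p : N}
    (hα : DifferentiableAt ℝ (α.inChart (j p)) (extChartAt (𝓡 d) (j p) (j p)))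
    (hj : ContMDiffAt (𝓡 e) (𝓡 d) 2 j p) (v w : TangentSpace (𝓡 e) p) :
    (α.pullback j : OneForm e N).extDeriv p ![v, w] =
      α.extDeriv (j p) ![mfderiv (𝓡 e) (𝓡 d) j p v, mfderiv (𝓡 e) (𝓡 d) j p w] := by
  have hp : writtenInExtChartAt (𝓡 e) (𝓡 d) p j (extChartAt (𝓡 e) p p) =
      extChartAt (𝓡 d) (j p) (j p) := by
    simp [writtenInExtChartAt]
  have hwritten : ContDiffAt ℝ 2 (writtenInExtChartAt (𝓡 e) (𝓡 d) p j) (extChartAt (𝓡 e) p p) := by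
    simpa [ContDiffAt, writtenInExtChartAt] using (contMDiffAt_iff.mp hj).2
  have hmfderiv : mfderiv (𝓡 e) (𝓡 d) j p =
      fderiv ℝ (writtenInExtChartAt (𝓡 e) (𝓡 d) p j) (extChartAt (𝓡 e) p p) := by
    rw [(hj.mdifferentiableAt two_ne_zero).mfderiv, ModelWithCorners.range_eq_univ,
      fderivWithin_univ]
  have hext := (α.inChart_pullback_eventuallyEq (hj.of_le one_le_two)).extDeriv_eq.trans
    (_root_.extDeriv_pullback (hp ▸ hα) hwritten (by simp))
  rw [OneForm.extDeriv, OneForm.extDeriv, hext, hp, mfderiv_extChartAt_self,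
    mfderiv_extChartAt_self, hmfderiv]
  refine congrArg (_root_.extDeriv (α.inChart (j p)) _) (funext fun i => ?_)
  fin_cases i <;> rfl

end Forms

section LevelSets

open Topology Set

variable {E E' F : Type*} [NormedAddCommGroup E] [NormedSpace ℝ E] [NormedAddCommGroup E']
  [NormedSpace ℝ E'] [NormedAddCommGroup F] [NormedSpace ℝ F] {n : WithTop ℕ∞}

theorem exists_openPartialHomeomorph_contDiffOn [CompleteSpace E] (hn : n ≠ 0) {f : E → E'}
    {U : Set E} (hU : IsOpen U) (hf : ContDiffOn ℝ n f U) {a : E} (ha : a ∈ U) {f' : E ≃L[ℝ] E'}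
    (hf' : HasFDerivAt f (f' : E →L[ℝ] E') a) :
    ∃ Ψ : OpenPartialHomeomorph E E', a ∈ Ψ.source ∧ Ψ.source ⊆ U ∧ ⇑Ψ = f ∧
      ContDiffOn ℝ n Ψ.symm Ψ.target := by
  have hfa : ContDiffAt ℝ n f a := hf.contDiffAt (hU.mem_nhds ha)
  let Ψ₀ := hfa.toOpenPartialHomeomorph f hf' hn
  let W : Set E := U ∩ fderiv ℝ f ⁻¹' range ((↑) : (E ≃L[ℝ] E') → E →L[ℝ] E')
  have hW : IsOpen W := (hf.continuousOn_fderiv_of_isOpen hU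
    (ENat.one_le_iff_ne_zero_withTop.mpr hn)).isOpen_inter_preimage hU ContinuousLinearEquiv.isOpen
  let Ψ := Ψ₀.restrOpen W hW
  have hsource : Ψ.source = Ψ₀.source ∩ W := Ψ₀.restrOpen_source W hW
  have hsub : Ψ.source ⊆ W := hsource ▸ inter_subset_right
  refine ⟨Ψ, ?_, hsub.trans inter_subset_left, rfl, fun y hy => ?_⟩
  · rw [hsource]
    exact ⟨hfa.mem_toOpenPartialHomeomorph_source hf' hn, ha, f', hf'.fderiv.symm⟩
  · obtain ⟨hyU, A, hA⟩ : Ψ.symm y ∈ W := hsub (Ψ.map_target hy)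
    have hfy : ContDiffAt ℝ n f (Ψ.symm y) := hf.contDiffAt (hU.mem_nhds hyU)
    refine (Ψ.contDiffAt_symm (f₀' := A) hy ?_ hfy).contDiffWithinAt
    rw [hA]
    exact (hfy.differentiableAt hn).hasFDerivAt

theorem exists_continuousLinearEquiv_prod_snd_eq [FiniteDimensional ℝ E]
    (ε : (E' × F) ≃L[ℝ] E) {A : E →L[ℝ] F} (hA : Function.Surjective A) :
    ∃ T : E ≃L[ℝ] E' × F, ∀ x, (T x).2 = A x := by
  have : FiniteDimensional ℝ (E' × F) := ε.symm.toLinearEquiv.finiteDimensional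
  have : FiniteDimensional ℝ E' := FiniteDimensional.of_injective (LinearMap.inl ℝ E' F)
    LinearMap.inl_injective
  have : FiniteDimensional ℝ F := FiniteDimensional.of_injective (LinearMap.inr ℝ E' F)
    LinearMap.inr_injective
  have hrange : A.toLinearMap.range = ⊤ := LinearMap.range_eq_top.mpr hA
  have hker : Module.finrank ℝ A.toLinearMap.ker = Module.finrank ℝ E' := by
    have h := A.toLinearMap.finrank_range_add_finrank_ker
    rw [hrange, finrank_top, ← ε.toLinearEquiv.finrank_eq, Module.finrank_prod] at h
    omega
  obtain ⟨C, hC⟩ := A.toLinearMap.ker.exists_isCompl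
  let T := LinearMap.equivProdOfSurjectiveOfIsCompl (A.toLinearMap.ker.projectionOnto C hC)
    A.toLinearMap (Submodule.range_projectionOnto hC) hrange
    (by rw [Submodule.ker_projectionOnto]; exact hC.symm)
  exact ⟨(T.trans ((LinearEquiv.ofFinrankEq _ _ hker).prodCongr
    (LinearEquiv.refl ℝ F))).toContinuousLinearEquiv, fun _ => rfl⟩

theorem exists_openPartialHomeomorph_snd_eq [FiniteDimensional ℝ E] (ε : (E' × F) ≃L[ℝ] E)
    (hn : n ≠ 0) {h : E → F} {U : Set E} (hU : IsOpen U) (hh : ContDiffOn ℝ n h U) {a : E}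
    (ha : a ∈ U) (hsurj : Function.Surjective (fderiv ℝ h a)) :
    ∃ Ψ : OpenPartialHomeomorph E E, a ∈ Ψ.source ∧ Ψ.source ⊆ U ∧ ContDiffOn ℝ n Ψ Ψ.source ∧
      ContDiffOn ℝ n Ψ.symm Ψ.target ∧ ∀ y, (ε.symm (Ψ y)).2 = h y := by
  have : CompleteSpace E := FiniteDimensional.complete ℝ E
  obtain ⟨T, hT⟩ := exists_continuousLinearEquiv_prod_snd_eq ε hsurj
  have hdiff : HasFDerivAt h (fderiv ℝ h a) a :=
    ((hh.contDiffAt (hU.mem_nhds ha)).differentiableAt hn).hasFDerivAt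
  let f : E → E := fun y => ε ((T y).1, h y)
  have hf : ContDiffOn ℝ n f U :=
    ε.contDiff.comp_contDiffOn (T.contDiff.fst.contDiffOn.prodMk hh)
  have hf' : HasFDerivAt f ((T.trans ε : E ≃L[ℝ] E) : E →L[ℝ] E) a := by
    have hTε : ((T.trans ε : E ≃L[ℝ] E) : E →L[ℝ] E) = (ε : E' × F →L[ℝ] E).comp
        (((ContinuousLinearMap.fst ℝ E' F).comp (T : E →L[ℝ] E' × F)).prod (fderiv ℝ h a)) := by
      ext y
      exact congrArg ε (Prod.ext rfl (hT y))
    rw [hTε]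
    exact ε.hasFDerivAt.comp a (T.hasFDerivAt.fst.prodMk hdiff)
  obtain ⟨Ψ, haΨ, hΨU, hΨ, hΨsymm⟩ := exists_openPartialHomeomorph_contDiffOn hn hU hf ha hf'
  refine ⟨Ψ, haΨ, hΨU, hΨ ▸ hf.mono hΨU, hΨsymm, fun y => ?_⟩
  rw [hΨ, ε.symm_apply_apply]

variable {X Y M : Type*} [TopologicalSpace X] [TopologicalSpace Y] [Zero Y] [TopologicalSpace M]

/-- `Φ` flattens `S` to the slice `X × {0}`. -/
def IsSliceChart (Φ : OpenPartialHomeomorph M (X × Y)) (S : Set M) : Prop :=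
  ∀ x ∈ Φ.source, x ∈ S ↔ (Φ x).2 = 0

namespace IsSliceChart

variable {S : Set M} {Φ : OpenPartialHomeomorph M (X × Y)}

theorem mk_fst_zero (hΦ : IsSliceChart Φ S) (x : S) (hx : (x : M) ∈ Φ.source) :
    ((Φ x).1, (0 : Y)) = Φ x :=
  Prod.ext rfl ((hΦ x hx).mp x.2).symm

theorem symm_mem (hΦ : IsSliceChart Φ S) {y : X} (hy : (y, (0 : Y)) ∈ Φ.target) :
    Φ.symm (y, 0) ∈ S := by
  rw [hΦ _ (Φ.map_target hy), Φ.right_inv hy]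

variable [Nonempty S]

theorem coe_invFun (hΦ : IsSliceChart Φ S) {y : X} (hy : (y, (0 : Y)) ∈ Φ.target) :
    Subtype.val (Function.invFun (Subtype.val : S → M) (Φ.symm (y, 0))) = Φ.symm (y, 0) :=
  Function.invFun_eq ⟨⟨_, hΦ.symm_mem hy⟩, rfl⟩

/-- The chart that a slice chart of `M` induces on `S`. -/
def chart (hΦ : IsSliceChart Φ S) : OpenPartialHomeomorph S X where
  toFun x := (Φ x).1
  invFun y := Function.invFun (Subtype.val : S → M) (Φ.symm (y, 0))
  source := Subtype.val ⁻¹' Φ.source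
  target := (fun y => (y, 0)) ⁻¹' Φ.target
  map_source' x hx := by
    rw [mem_preimage, hΦ.mk_fst_zero x hx]
    exact Φ.map_source hx
  map_target' y hy := by
    rw [mem_preimage, hΦ.coe_invFun hy]
    exact Φ.map_target hy
  left_inv' x hx := by
    rw [hΦ.mk_fst_zero x hx, Φ.left_inv hx]
    exact Function.leftInverse_invFun Subtype.val_injective x
  right_inv' y hy := by
    rw [hΦ.coe_invFun hy, Φ.right_inv hy]
  open_source := Φ.open_source.preimage continuous_subtype_val
  open_target := Φ.open_target.preimage (by fun_prop)
  continuousOn_toFun := continuous_fst.comp_continuousOn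
    (Φ.continuousOn.comp continuous_subtype_val.continuousOn fun _ h => h)
  continuousOn_invFun := IsInducing.subtypeVal.continuousOn_iff.mpr
    ((Φ.continuousOn_symm.comp (by fun_prop : Continuous fun y : X => (y, (0 : Y))).continuousOn
      fun _ h => h).congr fun _ hy => hΦ.coe_invFun hy)

theorem coe_chart_symm (hΦ : IsSliceChart Φ S) {y : X} (hy : y ∈ hΦ.chart.target) :
    (hΦ.chart.symm y : M) = Φ.symm (y, 0) :=
  hΦ.coe_invFun hy

end IsSliceChart

variable {M : Type*} [TopologicalSpace M]

theorem IsSliceChart.contDiffOn_chart_symm_trans_chart {S : Set M} [Nonempty S]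
    {Φ Φ' : OpenPartialHomeomorph M (E' × F)}
    (hΦ : IsSliceChart Φ S) (hΦ' : IsSliceChart Φ' S)
    (h : ContDiffOn ℝ n (Φ.symm ≫ₕ Φ') (Φ.symm ≫ₕ Φ').source) :
    ContDiffOn ℝ n (hΦ.chart.symm ≫ₕ hΦ'.chart) (hΦ.chart.symm ≫ₕ hΦ'.chart).source := by
  have hslice : ContDiffOn ℝ n (fun y : E' => (y, (0 : F)))
      (hΦ.chart.symm ≫ₕ hΦ'.chart).source := (contDiff_id.prodMk contDiff_const).contDiffOn
  refine (contDiff_fst.comp_contDiffOn (h.comp hslice fun y hy => ⟨hy.1, ?_⟩)).congr fun y hy => ?_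
  · change Φ.symm (y, 0) ∈ Φ'.source
    rw [← hΦ.coe_chart_symm hy.1]
    exact hy.2
  · exact congrArg (fun x => (Φ' x).1) (hΦ.coe_chart_symm hy.1)

variable [ChartedSpace E M] (ε : (E' × F) ≃L[ℝ] E)

theorem exists_slice_chart [FiniteDimensional ℝ E] [IsManifold 𝓘(ℝ, E) n M] (hn : n ≠ 0)
    {g : M → F} (hg : ContMDiff 𝓘(ℝ, E) 𝓘(ℝ, F) n g) (p : M)
    (hp : Function.Surjective (mvfderiv 𝓘(ℝ, E) g p)) :
    ∃ Φ ∈ IsManifold.maximalAtlas 𝓘(ℝ, E) n M, p ∈ Φ.source ∧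
      ∀ x ∈ Φ.source, (ε.symm (Φ x)).2 = g x := by
  let φ := chartAt E p
  have hgφ : ContDiffOn ℝ n (g ∘ φ.symm) φ.target :=
    contMDiffOn_iff_contDiffOn.mp (hg.comp_contMDiffOn contMDiffOn_chart_symm)
  have hsurj : Function.Surjective (fderiv ℝ (g ∘ φ.symm) (φ p)) := by
    have h := (hg.mdifferentiableAt hn).mvfderiv (x := p)
    rw [ModelWithCorners.range_eq_univ, fderivWithin_univ] at h
    exact h ▸ hp
  obtain ⟨Ψ, haΨ, -, hΨ, hΨsymm, hΨg⟩ := exists_openPartialHomeomorph_snd_eq ε hn φ.open_target hgφ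
    (mem_chart_target E p) hsurj
  refine ⟨φ ≫ₕ Ψ, ?_, ⟨mem_chart_source E p, haΨ⟩, fun x hx => ?_⟩
  · refine OpenPartialHomeomorph.mem_maximalAtlas_of_contMDiffOn _ ?_ ?_
    · exact (contMDiffOn_iff_contDiffOn.mpr hΨ).comp (contMDiffOn_chart.mono inter_subset_left)
        inter_subset_right
    · exact contMDiffOn_chart_symm.comp
        ((contMDiffOn_iff_contDiffOn.mpr hΨsymm).mono inter_subset_left) inter_subset_right
  · exact (hΨg (φ x)).trans (congrArg g (φ.left_inv hx.1))

variable {ε}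

theorem exists_isSmoothEmbedding_of_slice_charts {S : Set M}
    (h : ∀ p ∈ S, ∃ Φ ∈ IsManifold.maximalAtlas 𝓘(ℝ, E) n M, p ∈ Φ.source ∧
      IsSliceChart (Φ.transHomeomorph ε.symm.toHomeomorph) S) :
    ∃ _ : ChartedSpace E' S, IsManifold 𝓘(ℝ, E') n S ∧
      Manifold.IsSmoothEmbedding 𝓘(ℝ, E') 𝓘(ℝ, E) n ((↑) : S → M) := by
  choose Φ hΦatlas hpΦ hΦ using fun p : S => h p p.2
  let ψ (p : S) : OpenPartialHomeomorph S E' :=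
    have : Nonempty S := ⟨p⟩
    (hΦ p).chart
  let cs : ChartedSpace E' S :=
    { atlas := range ψ
      chartAt := ψ
      mem_chart_source := hpΦ
      chart_mem_atlas := mem_range_self }
  have hmanifold : IsManifold 𝓘(ℝ, E') n S := by
    refine isManifold_of_contDiffOn _ _ _ ?_
    rintro _ _ ⟨p, rfl⟩ ⟨q, rfl⟩
    have : Nonempty S := ⟨p⟩
    have htrans : ContDiffOn ℝ n ((Φ p).symm ≫ₕ Φ q) ((Φ p).symm ≫ₕ Φ q).source :=
      contMDiffOn_iff_contDiffOn.mp (contMDiffOn_of_mem_contDiffGroupoid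
        (IsManifold.compatible_of_mem_maximalAtlas (hΦatlas p) (hΦatlas q)))
    have hε := ε.symm.contDiff.comp_contDiffOn
      (htrans.comp ε.contDiff.contDiffOn (Subset.refl (ε ⁻¹' _)))
    simpa [ψ] using (hΦ p).contDiffOn_chart_symm_trans_chart (hΦ q) hε
  refine ⟨cs, hmanifold, Manifold.IsImmersionOfComplement.isImmersion (F := F) fun p => ?_,
    IsEmbedding.subtypeVal⟩
  refine Manifold.IsImmersionAtOfComplement.mk_of_charts ε (ψ p) (Φ p) (hpΦ p) (hpΦ p)
    (IsManifold.chart_mem_maximalAtlas p) (hΦatlas p) (fun x hx => hx) fun y hy => ?_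
  have : Nonempty S := ⟨p⟩
  have hy' : y ∈ (ψ p).target := by simpa using hy
  exact (congrArg (Φ p) ((hΦ p).coe_chart_symm hy')).trans ((Φ p).right_inv hy')

theorem exists_isSmoothEmbedding_of_isEmpty (S : Set M) [IsEmpty S] :
    ∃ _ : ChartedSpace E' S, IsManifold 𝓘(ℝ, E') n S ∧
      Manifold.IsSmoothEmbedding 𝓘(ℝ, E') 𝓘(ℝ, E) n ((↑) : S → M) :=
  let cs : ChartedSpace E' S := ChartedSpace.empty _ _
  ⟨cs, isManifold_of_contDiffOn _ _ _ fun _ _ h => h.elim,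
    Manifold.IsImmersionOfComplement.isImmersion (F := ℝ) isEmptyElim, IsEmbedding.subtypeVal⟩

variable {N : Type*} [TopologicalSpace N] [ChartedSpace E' N]

theorem mfderiv_injective_of_isImmersionAt {j : N → M} {x : N} (hn : n ≠ 0)
    (h : Manifold.IsImmersionAt 𝓘(ℝ, E') 𝓘(ℝ, E) n j x) :
    Function.Injective (mfderiv 𝓘(ℝ, E') 𝓘(ℝ, E) j x) := by
  let ψ := h.domChart
  let Φ := h.codChart
  let ι : E' →L[ℝ] E := (h.equiv : E' × h.complement →L[ℝ] E).comp (ContinuousLinearMap.inl ℝ _ _)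
  have hxψ : x ∈ ψ.source := h.mem_domChart_source
  have hψ : ψ.MDifferentiable 𝓘(ℝ, E') 𝓘(ℝ, E') :=
    ⟨(contMDiffOn_of_mem_maximalAtlas h.domChart_mem_maximalAtlas).mdifferentiableOn hn,
      (contMDiffOn_symm_of_mem_maximalAtlas h.domChart_mem_maximalAtlas).mdifferentiableOn hn⟩
  have hΦ : MDifferentiableAt 𝓘(ℝ, E) 𝓘(ℝ, E) Φ (j x) :=
    (contMDiffAt_of_mem_maximalAtlas h.codChart_mem_maximalAtlas
      h.mem_codChart_source).mdifferentiableAt hn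
  have hΦj : Φ ∘ j =ᶠ[𝓝 x] ι ∘ ψ := by
    filter_upwards [ψ.open_source.mem_nhds hxψ] with z hz
    have hz' := h.writtenInCharts (show ψ z ∈ (ψ.extend 𝓘(ℝ, E')).target by
      simpa using ψ.map_source hz)
    exact (congrArg (fun w => Φ (j w)) (ψ.left_inv hz).symm).trans hz'
  have hderiv : (mfderiv 𝓘(ℝ, E) 𝓘(ℝ, E) Φ (j x)).comp (mfderiv 𝓘(ℝ, E') 𝓘(ℝ, E) j x) =
      ι.comp (mfderiv 𝓘(ℝ, E') 𝓘(ℝ, E') ψ x) := by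
    have hι : mfderiv 𝓘(ℝ, E') 𝓘(ℝ, E) ι (ψ x) = ι := ι.mfderiv_eq
    rw [← mfderiv_comp x hΦ (h.contMDiffAt.mdifferentiableAt hn), hΦj.mfderiv_eq,
      mfderiv_comp x ι.mdifferentiableAt (hψ.mdifferentiableAt hxψ), hι]
    rfl
  have hinj : Function.Injective (ι.comp (mfderiv 𝓘(ℝ, E') 𝓘(ℝ, E') ψ x)) :=
    (h.equiv.injective.comp LinearMap.inl_injective).comp (hψ.mfderiv_injective hxψ)
  rw [← hderiv] at hinj
  exact Function.Injective.of_comp hinj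

end LevelSets

section Pointwise

/-- The numbering of the vectors of a frame of a contact manifold: the first one fills the slot of
`α`, and the others come in consecutive pairs, one for each factor `dα`. -/
def pairEquiv (n : ℕ) : Fin (2 * n + 1) ≃ Option (Fin n × Fin 2) :=
  (finSuccEquiv (2 * n)).trans
    (Equiv.optionCongr ((finCongr (Nat.mul_comm 2 n)).trans finProdFinEquiv.symm))

theorem pairEquiv_symm_none (n : ℕ) : (pairEquiv n).symm none = 0 := by
  rw [Equiv.symm_apply_eq, pairEquiv, Equiv.trans_apply, finSuccEquiv_zero,
    Equiv.optionCongr_apply, Option.map_none]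

theorem pairEquiv_symm_some {n : ℕ} (i : Fin n) (b : Fin 2) :
    (pairEquiv n).symm (some (i, b)) = ⟨2 * i + 1 + b, by lia⟩ := by
  rw [Equiv.symm_apply_eq]
  have hsucc : (⟨2 * i + 1 + b, by lia⟩ : Fin (2 * n + 1)) = Fin.succ ⟨2 * i + b, by lia⟩ :=
    Fin.ext (Nat.add_right_comm _ _ _)
  rw [hsucc, pairEquiv, Equiv.trans_apply, finSuccEquiv_succ, Equiv.optionCongr_apply,
    Option.map_some, Equiv.trans_apply, Option.some_inj, eq_comm, Equiv.symm_apply_eq]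
  exact Fin.ext (Nat.add_comm _ _)

variable {d : ℕ} {M : Type*} [TopologicalSpace M] [ChartedSpace (EuclideanSpace ℝ (Fin d)) M]

instance (x : M) : FiniteDimensional ℝ (TangentSpace (𝓡 d) x) :=
  inferInstanceAs (FiniteDimensional ℝ (EuclideanSpace ℝ (Fin d)))

theorem finrank_tangentSpace (x : M) : Module.finrank ℝ (TangentSpace (𝓡 d) x) = d :=
  finrank_euclideanSpace_fin (𝕜 := ℝ) (n := d)

/-- The value at a point of the exterior derivative of a 1-form, as a bilinear form. -/
def OneForm.bilin (α : OneForm d M) (x : M) : LinearMap.BilinForm ℝ (TangentSpace (𝓡 d) x) :=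
  LinearMap.mk₂ ℝ (fun v w => α.extDeriv x ![v, w])
    (fun v v' w => (α.extDeriv x).toAlternatingMap.map_vecCons_add ![w] v v')
    (fun c v w => (α.extDeriv x).toAlternatingMap.map_vecCons_smul ![w] c v)
    (fun v w w' => ((α.extDeriv x).toAlternatingMap.curryLeft v).map_vecCons_add ![] w w')
    (fun c v w => ((α.extDeriv x).toAlternatingMap.curryLeft v).map_vecCons_smul ![] c w)

theorem OneForm.bilin_apply (α : OneForm d M) (x : M) (v w : TangentSpace (𝓡 d) x) :
    α.bilin x v w = α.extDeriv x ![v, w] :=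
  rfl

theorem OneForm.bilin_isAlt (α : OneForm d M) (x : M) : (α.bilin x).IsAlt := fun v =>
  (α.extDeriv x).map_eq_zero_of_eq ![v, v] (i := 0) (j := 1) rfl (by simp)

/-- The contact condition at a point. It is stated in any dimension as the nondegeneracy of the
pair `(α, dα)`, rather than through the volume form `α ∧ (dα)^n`. -/
def IsContactAt (α : OneForm d M) (x : M) : Prop :=
  IsContactPair (α x).toLinearMap (α.bilin x)

theorem contactVolume_eq_contactTopForm {n : ℕ}
    [ChartedSpace (EuclideanSpace ℝ (Fin (2 * n + 1))) M]
    (α : OneForm (2 * n + 1) M) (x : M)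
    (v : Fin (2 * n + 1) → TangentSpace (𝓡 (2 * n + 1)) x) :
    contactVolume α x v = (1 / 2 ^ n) *
      contactTopForm (α x).toLinearMap (α.bilin x) (v ∘ (pairEquiv n).symm) := by
  rw [contactVolume, contactTopForm_apply]
  congr 1
  refine Fintype.sum_equiv (pairEquiv n).permCongr _ _ fun σ => ?_
  rw [Equiv.Perm.sign_permCongr, contactProduct_apply]
  simp [pairEquiv_symm_none, pairEquiv_symm_some, OneForm.bilin_apply, add_assoc]

theorem isContactAt_iff_contactVolume {n : ℕ}
    [ChartedSpace (EuclideanSpace ℝ (Fin (2 * n + 1))) M]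
    (α : OneForm (2 * n + 1) M) (x : M) :
    IsContactAt α x ↔ ∃ v, contactVolume α x v ≠ 0 := by
  simp only [contactVolume_eq_contactTopForm]
  constructor
  · intro h
    obtain ⟨v, hv⟩ := DFunLike.ne_iff.mp
      (h.contactTopForm_ne_zero (α.bilin_isAlt x) (finrank_tangentSpace x))
    refine ⟨v ∘ pairEquiv n, mul_ne_zero (by positivity) ?_⟩
    simpa [Function.comp_assoc] using hv
  · rintro ⟨v, hv⟩
    refine .of_contactTopForm_ne_zero (ι := Fin n) (α.bilin_isAlt x) ?_ fun h => hv (by simp [h])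
    simp [finrank_tangentSpace, mul_comm]

variable {α : OneForm d M} {x : M}

namespace IsContactAt

theorem isReebVector_reeb (h : IsContactAt α x) (hd : Odd d) : IsReebVector α x (reeb α x) :=
  Classical.epsilon_spec (h.exists_reeb (α.bilin_isAlt x) (by rwa [finrank_tangentSpace]))

theorem eq_reeb (h : IsContactAt α x) (hd : Odd d) {z : TangentSpace (𝓡 d) x}
    (hz : IsReebVector α x z) : z = reeb α x :=
  have hr := h.isReebVector_reeb hd
  h.ext (hz.1.trans hr.1.symm) fun w => (hz.2 w).trans (hr.2 w).symm

theorem sharp_spec (h : IsContactAt α x) (hd : Odd d) {η : TangentSpace (𝓡 d) x →L[ℝ] ℝ}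
    (hη : η (reeb α x) = 0) :
    α x (sharp α x η) = 0 ∧ ∀ w, -α.bilin x (sharp α x η) w = η w :=
  have hr := h.isReebVector_reeb hd
  Classical.epsilon_spec (p := fun v => α x v = 0 ∧ ∀ w, -α.extDeriv x ![v, w] = η w)
    (h.exists_sharp (α.bilin_isAlt x) hr.1 hr.2 (η := η.toLinearMap) hη)

theorem contactHam_spec (h : IsContactAt α x) (hd : Odd d) (f : M → ℝ) :
    α x (contactHam α f x) = f x ∧ ∀ w, -α.bilin x (contactHam α f x) w =
      differential f x w - differential f x (reeb α x) * α x w := by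
  have hr := h.isReebVector_reeb hd
  have hs := h.sharp_spec hd (η := differential f x - differential f x (reeb α x) • α x)
    (by simp [hr.1])
  have hBr : ∀ w, α.bilin x (reeb α x) w = 0 := hr.2
  refine ⟨by simp [contactHam, hr.1, hs.1], fun w => ?_⟩
  simpa [contactHam, hBr] using hs.2 w

theorem eq_contactHam (h : IsContactAt α x) (hd : Odd d) {f : M → ℝ} {v : TangentSpace (𝓡 d) x}
    (hα : α x v = f x) (hv : ∀ w, -α.bilin x v w =
      differential f x w - differential f x (reeb α x) * α x w) : v = contactHam α f x :=
  have hs := h.contactHam_spec hd f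
  h.ext (hα.trans hs.1.symm) fun w => neg_injective ((hv w).trans (hs.2 w).symm)

theorem jacobiBracket_antisymm (h : IsContactAt α x) (hd : Odd d) (f g : M → ℝ) :
    jacobiBracket α f g x = -jacobiBracket α g f x := by
  have hf := h.contactHam_spec hd f
  have hg := h.contactHam_spec hd g
  have hfg := hf.2 (contactHam α g x)
  have hgf := hg.2 (contactHam α f x)
  rw [hg.1] at hfg
  rw [hf.1] at hgf
  have halt := (α.bilin_isAlt x).neg_eq (contactHam α f x) (contactHam α g x)
  simp only [jacobiBracket]
  linarith

theorem jacobiBracket_eq_neg_differential (h : IsContactAt α x) (hd : Odd d) (f : M → ℝ)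
    {g : M → ℝ} (hg : g x = 0) :
    jacobiBracket α g f x = -differential g x (contactHam α f x) := by
  rw [h.jacobiBracket_antisymm hd, jacobiBracket, hg, zero_mul, sub_zero]

theorem jacobiBracket_one (h : IsContactAt α x) (hd : Odd d) (g : M → ℝ) :
    jacobiBracket α (fun _ => 1) g x = differential g x (reeb α x) := by
  have hr := h.isReebVector_reeb hd
  have hone : differential (d := d) (fun _ : M => (1 : ℝ)) x = 0 := mvfderiv_const _
  have hreeb : reeb α x = contactHam α (fun _ => 1) x :=
    h.eq_contactHam hd hr.1 fun w => by simp [OneForm.bilin_apply, hr.2, hone]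
  simp [jacobiBracket, ← hreeb, hone]

theorem bilin_contactHam_of_differential_reeb_eq_zero (h : IsContactAt α x) (hd : Odd d)
    {g : M → ℝ} (hg : differential g x (reeb α x) = 0) (w : TangentSpace (𝓡 d) x) :
    α.bilin x (contactHam α g x) w = -differential g x w := by
  rw [eq_neg_iff_add_eq_zero, add_comm, ← sub_neg_eq_add, (h.contactHam_spec hd g).2, hg]
  simp

theorem eq_zero_of_mem_ker (h : IsContactAt α x) (hd : Odd d) {v : TangentSpace (𝓡 d) x}
    (hv : α x v = 0) (hvw : ∀ w, α x w = 0 → α.extDeriv x ![v, w] = 0) : v = 0 := by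
  have hr := h.isReebVector_reeb hd
  have := h.separatingLeft_restrict_ker (α.bilin_isAlt x) hr.1 hr.2 ⟨v, hv⟩
    fun w => hvw w w.2
  exact congrArg Subtype.val this

theorem sup_ker_eq_top (h : IsContactAt α x) (hd : Odd d)
    {L : Submodule ℝ (TangentSpace (𝓡 d) x)} (hL : reeb α x ∈ L) : L ⊔ (α x).ker = ⊤ := by
  have hr := (h.isReebVector_reeb hd).1
  refine top_unique ((LinearMap.span_singleton_sup_ker_eq_top (α x).toLinearMap
    (x := reeb α x) (hr.trans_ne one_ne_zero)).ge.trans ?_)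
  exact sup_le_sup_right ((Submodule.span_singleton_le_iff_mem _ _).mpr hL) _

end IsContactAt

end Pointwise

section Constraints

variable {d : ℕ} {ι M : Type*} [TopologicalSpace M] [ChartedSpace (EuclideanSpace ℝ (Fin d)) M]
  {α : OneForm d M} {G : ι → M → ℝ} {x : M}

theorem bracketMatrix_eq_of_differential (hx : ∀ i, G i x = 0) :
    bracketMatrix α G x =
      Matrix.of fun i j => differential (G i) x (contactHam α (G j) x) := by
  ext i j
  simp [bracketMatrix, jacobiBracket, hx i]

theorem differential_correctedHam [Fintype ι] (hx : ∀ i, G i x = 0) (f : M → ℝ) (c : ι → ℝ) :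
    (fun j => differential (G j) x (correctedHam α G f c x)) =
      (fun j => differential (G j) x (contactHam α f x)) - (bracketMatrix α G x).mulVec c := by
  ext j
  rw [bracketMatrix_eq_of_differential hx]
  simp [correctedHam, Matrix.mulVec, dotProduct, mul_comm]

variable [Fintype ι] [DecidableEq ι]

theorem exists_differential_eq (hx : ∀ i, G i x = 0) (hdet : (bracketMatrix α G x).det ≠ 0)
    (u : ι → ℝ) : ∃ v : TangentSpace (𝓡 d) x, ∀ i, differential (G i) x v = u i := by
  rw [bracketMatrix_eq_of_differential hx] at hdet
  obtain ⟨c, hc⟩ :=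
    exists_apply_sum_smul_eq (D := fun i => (differential (G i) x).toLinearMap) hdet u
  exact ⟨_, hc⟩

theorem card_add_finrank_ker_differential (hx : ∀ i, G i x = 0)
    (hdet : (bracketMatrix α G x).det ≠ 0) :
    Fintype.card ι + Module.finrank ℝ
      (LinearMap.pi fun i => (differential (d := d) (G i) x).toLinearMap).ker = d := by
  let D := LinearMap.pi fun i => (differential (d := d) (G i) x).toLinearMap
  have hsurj : Function.Surjective D := fun u =>
    (exists_differential_eq hx hdet u).imp fun _ hv => funext hv
  have hrank := D.finrank_range_add_finrank_ker
  rwa [LinearMap.range_eq_top.mpr hsurj, finrank_top, Module.finrank_fintype_fun_eq_card,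
    finrank_tangentSpace] at hrank

theorem card_le_of_det_bracketMatrix_ne_zero (hx : ∀ i, G i x = 0)
    (hdet : (bracketMatrix α G x).det ≠ 0) : Fintype.card ι ≤ d :=
  (Nat.le_add_right _ _).trans (card_add_finrank_ker_differential hx hdet).le

theorem differential_correctedHam_eq_zero_iff (hx : ∀ i, G i x = 0)
    (hdet : (bracketMatrix α G x).det ≠ 0) (f : M → ℝ) (c : ι → ℝ) :
    (∀ j, differential (G j) x (correctedHam α G f c x) = 0) ↔
      c = (bracketMatrix α G x)⁻¹.mulVec fun j => differential (G j) x (contactHam α f x) := by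
  rw [← funext_iff (g := fun _ => (0 : ℝ)), differential_correctedHam hx f c]
  constructor
  · intro h
    rw [sub_eq_zero.mp h, Matrix.mulVec_mulVec, Matrix.nonsing_inv_mul _ hdet.isUnit,
      Matrix.one_mulVec]
  · rintro rfl
    rw [Matrix.mulVec_mulVec, Matrix.mul_nonsing_inv _ hdet.isUnit, Matrix.one_mulVec, sub_self]
    rfl

theorem existsUnique_isMultiplier (hdet : ∀ x ∈ zeroLocus G, (bracketMatrix α G x).det ≠ 0)
    (f : M → ℝ) : ∃! c : ι → zeroLocus G → ℝ, IsMultiplier α G f c := by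
  have hiff := fun (x : zeroLocus G) c =>
    differential_correctedHam_eq_zero_iff x.2 (hdet x x.2) f c
  exact ⟨fun i x => _, fun x => (hiff x _).mpr rfl, fun c hc => funext fun i => funext fun x =>
    congrFun ((hiff x _).mp (hc x)) i⟩

end Constraints

section Pullback

variable {d e : ℕ} {M N : Type*} [TopologicalSpace M] [ChartedSpace (EuclideanSpace ℝ (Fin d)) M]
  [TopologicalSpace N] [ChartedSpace (EuclideanSpace ℝ (Fin e)) N]
  {α : OneForm d M} {j : N → M} {x : N}

theorem differential_comp (hj : MDifferentiableAt (𝓡 e) (𝓡 d) j x) {f : M → ℝ}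
    (hf : MDifferentiableAt (𝓡 d) 𝓘(ℝ, ℝ) f (j x)) (v : TangentSpace (𝓡 e) x) :
    differential (d := e) (f ∘ j) x v = differential f (j x) (mfderiv (𝓡 e) (𝓡 d) j x v) :=
  mvfderiv_comp_apply x hf hj v

variable [IsManifold (𝓡 d) ∞ M] [IsManifold (𝓡 e) ∞ N]

theorem mfderiv_reeb_pullback (hα : α.IsSmooth) (hj : ContMDiffAt (𝓡 e) (𝓡 d) 2 j x)
    (hd : Odd d) (he : Odd e) (h : IsContactAt α (j x))
    (h' : IsContactAt (d := e) (α.pullback j) x)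
    (hZ : reeb α (j x) ∈ (mfderiv (𝓡 e) (𝓡 d) j x).range) :
    mfderiv (𝓡 e) (𝓡 d) j x (reeb (α.pullback j) x) = reeb α (j x) := by
  obtain ⟨z, hz⟩ := hZ
  have hr := h.isReebVector_reeb hd
  rw [← hz] at hr
  have hz' : IsReebVector (α.pullback j : OneForm e N) x z :=
    ⟨hr.1, fun w => (OneForm.extDeriv_pullback (hα.differentiableAt_inChart _) hj z w).trans
      (hr.2 _)⟩
  rw [← h'.eq_reeb he hz']
  exact hz

theorem mfderiv_contactHam_pullback (hα : α.IsSmooth) (hj : ContMDiffAt (𝓡 e) (𝓡 d) 2 j x)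
    (hd : Odd d) (he : Odd e) (h : IsContactAt α (j x))
    (h' : IsContactAt (d := e) (α.pullback j) x)
    (hZ : reeb α (j x) ∈ (mfderiv (𝓡 e) (𝓡 d) j x).range) {f : M → ℝ}
    (hf : MDifferentiableAt (𝓡 d) 𝓘(ℝ, ℝ) f (j x)) {W : TangentSpace (𝓡 d) (j x)}
    (hW : W ∈ (mfderiv (𝓡 e) (𝓡 d) j x).range) (hαW : α (j x) W = f (j x))
    (hBW : ∀ w ∈ (mfderiv (𝓡 e) (𝓡 d) j x).range, -α.bilin (j x) W w =
      differential f (j x) w - differential f (j x) (reeb α (j x)) * α (j x) w) :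
    mfderiv (𝓡 e) (𝓡 d) j x (contactHam (α.pullback j) (f ∘ j) x) = W := by
  obtain ⟨v, rfl⟩ := hW
  have hj' := hj.mdifferentiableAt two_ne_zero
  refine congrArg (mfderiv (𝓡 e) (𝓡 d) j x)
    (h'.eq_contactHam (f := f ∘ j) (v := v) he hαW fun w => ?_).symm
  rw [differential_comp hj' hf, differential_comp hj' hf,
    mfderiv_reeb_pullback hα hj hd he h h' hZ]
  exact (congrArg Neg.neg (OneForm.extDeriv_pullback (hα.differentiableAt_inChart _) hj v w)).trans
    (hBW _ ⟨w, rfl⟩)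

end Pullback

theorem isContactSubmanifold_of_isContactAt {d m : ℕ} {M N : Type*} [TopologicalSpace M]
    [ChartedSpace (EuclideanSpace ℝ (Fin d)) M] [IsManifold (𝓡 d) ∞ M] [TopologicalSpace N]
    [ChartedSpace (EuclideanSpace ℝ (Fin (2 * m + 1))) N] [IsManifold (𝓡 (2 * m + 1)) ∞ N]
    {α : OneForm d M} {j : N → M} (hα : α.IsSmooth)
    (hj : Manifold.IsSmoothEmbedding (𝓡 (2 * m + 1)) (𝓡 d) ∞ j) (hd : Odd d)
    (h : ∀ x, IsContactAt α (j x)) (h' : ∀ x, IsContactAt (d := 2 * m + 1) (α.pullback j) x)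
    (hZ : ∀ x, reeb α (j x) ∈ (mfderiv (𝓡 (2 * m + 1)) (𝓡 d) j x).range) :
    IsContactSubmanifold (m := m) α j where
  isSmoothEmbedding := hj
  transverse x := (h x).sup_ker_eq_top hd (hZ x)
  nondegenerate x _ hv hvw := (h' x).eq_zero_of_mem_ker (odd_two_mul_add_one m) hv hvw
  isContactForm :=
    ⟨hα.pullback hj.contMDiff, fun x => (isContactAt_iff_contactVolume _ x).mp (h' x)⟩

theorem mvfderiv_clm_comp {d : ℕ} {M F : Type*} [TopologicalSpace M]
    [ChartedSpace (EuclideanSpace ℝ (Fin d)) M] [NormedAddCommGroup F] [NormedSpace ℝ F]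
    {g : M → F} {x : M} (hg : MDifferentiableAt (𝓡 d) 𝓘(ℝ, F) g x) (L : F →L[ℝ] ℝ)
    (v : TangentSpace (𝓡 d) x) :
    mvfderiv (𝓡 d) (L ∘ g) x v = L (mvfderiv (𝓡 d) g x v) := by
  have h := mfderiv_comp x (L.mdifferentiableAt (x := g x)) hg
  rw [ContinuousLinearMap.mfderiv_eq] at h
  exact congrArg (fun A => A v) h

section ZeroLocus

variable {d e : ℕ} {ι M : Type*} [Fintype ι] [DecidableEq ι] [TopologicalSpace M]
  [ChartedSpace (EuclideanSpace ℝ (Fin d)) M]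
  {α : OneForm d M} {G : ι → M → ℝ}

theorem mem_range_mfderiv_incl_iff [ChartedSpace (EuclideanSpace ℝ (Fin e)) (zeroLocus G)]
    [IsManifold (𝓡 e) ∞ (zeroLocus G)] (x : zeroLocus G)
    (hG : ∀ i, MDifferentiableAt (𝓡 d) 𝓘(ℝ, ℝ) (G i) (x : M))
    (hdet : (bracketMatrix α G (x : M)).det ≠ 0) (he : Fintype.card ι + e = d)
    (hj : Manifold.IsImmersionAt (𝓡 e) (𝓡 d) ∞ (incl G) x) (v : TangentSpace (𝓡 d) (x : M)) :
    v ∈ (mfderiv (𝓡 e) (𝓡 d) (incl G) x).range ↔ ∀ i, differential (G i) (x : M) v = 0 := by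
  let D := LinearMap.pi fun i => (differential (d := d) (G i) (x : M)).toLinearMap
  have hle : (mfderiv (𝓡 e) (𝓡 d) (incl G) x).range ≤ D.ker := by
    rintro _ ⟨w, rfl⟩
    refine funext fun i => (differential_comp
      (hj.contMDiffAt.mdifferentiableAt (by simp)) (hG i) w).symm.trans ?_
    rw [show G i ∘ incl G = fun _ => 0 from funext fun y => y.2 i, differential, mvfderiv_const]
    rfl
  have hrank : Module.finrank ℝ (mfderiv (𝓡 e) (𝓡 d) (incl G) x).range =
      Module.finrank ℝ D.ker := by
    have hrange := LinearMap.finrank_range_of_inj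
      (mfderiv_injective_of_isImmersionAt (by simp) hj)
    rw [finrank_tangentSpace] at hrange
    have hker := card_add_finrank_ker_differential x.2 hdet
    exact hrange.trans (Nat.add_left_cancel (he.trans hker.symm))
  rw [Submodule.eq_of_le_of_finrank_eq hle hrank, LinearMap.mem_ker, funext_iff]
  rfl

theorem exists_isSmoothEmbedding_incl [IsManifold (𝓡 d) ∞ M] (hG : ∀ i, IsSmoothFun d (G i))
    (hdet : ∀ x ∈ zeroLocus G, (bracketMatrix α G x).det ≠ 0)
    (he : (zeroLocus G).Nonempty → Fintype.card ι + e = d) :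
    ∃ _ : ChartedSpace (EuclideanSpace ℝ (Fin e)) (zeroLocus G),
      IsManifold (𝓡 e) ∞ (zeroLocus G) ∧
      Manifold.IsSmoothEmbedding (𝓡 e) (𝓡 d) ∞ (incl G) := by
  rcases isEmpty_or_nonempty (zeroLocus G) with hempty | hne
  · exact exists_isSmoothEmbedding_of_isEmpty _
  have hdim := he (Set.nonempty_coe_sort.mp hne)
  let ε : (EuclideanSpace ℝ (Fin e) × EuclideanSpace ℝ ι) ≃L[ℝ] EuclideanSpace ℝ (Fin d) :=
    ContinuousLinearEquiv.ofFinrankEq (by simp; lia)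
  let g : M → EuclideanSpace ℝ ι := fun x => WithLp.toLp 2 fun i => G i x
  have hg : ContMDiff (𝓡 d) 𝓘(ℝ, EuclideanSpace ℝ ι) ∞ g :=
    (EuclideanSpace.equiv ι ℝ).symm.contDiff.contMDiff.comp (contMDiff_pi_space.mpr hG)
  refine exists_isSmoothEmbedding_of_slice_charts (ε := ε) fun p hp => ?_
  have hsurj : Function.Surjective (mvfderiv (𝓡 d) g p) := fun u => by
    obtain ⟨v, hv⟩ := exists_differential_eq hp (hdet p hp) u
    refine ⟨v, PiLp.ext fun i => ?_⟩
    rw [← hv i]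
    exact (mvfderiv_clm_comp (hg.contMDiffAt.mdifferentiableAt (by simp))
      (EuclideanSpace.proj i : EuclideanSpace ℝ ι →L[ℝ] ℝ) v).symm
  obtain ⟨Φ, hΦ, hpΦ, hΦg⟩ := exists_slice_chart ε (by simp) hg p hsurj
  refine ⟨Φ, hΦ, hpΦ, fun x hx => ?_⟩
  rw [show (Φ.transHomeomorph ε.symm.toHomeomorph x).2 = g x from hΦg x hx, PiLp.ext_iff]
  rfl

end ZeroLocus

section SecondClass

variable {d : ℕ} {ι M : Type*} [Fintype ι] [DecidableEq ι] [TopologicalSpace M]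
  [ChartedSpace (EuclideanSpace ℝ (Fin d)) M]

/-- The point `x` lies on the common zero set of the functions `G i`, the form `α` is contact
there, the `G i` are invariant under the Reeb flow to first order and their matrix of brackets is
invertible: at `x` they are second class constraints in the sense of Dirac. -/
structure IsSecondClassAt (α : OneForm d M) (G : ι → M → ℝ) (x : M) : Prop where
  isContactAt : IsContactAt α x
  eq_zero : ∀ i, G i x = 0
  differential_reeb : ∀ i, differential (G i) x (reeb α x) = 0
  det_ne_zero : (bracketMatrix α G x).det ≠ 0

namespace IsSecondClassAt

variable {α : OneForm d M} {G : ι → M → ℝ} {x : M}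

theorem apply_correctedHam (h : IsSecondClassAt α G x) (hd : Odd d) (f : M → ℝ) (c : ι → ℝ) :
    α x (correctedHam α G f c x) = f x := by
  simp [correctedHam, (h.isContactAt.contactHam_spec hd _).1, h.eq_zero]

theorem bilin_correctedHam (h : IsSecondClassAt α G x) (hd : Odd d) (f : M → ℝ) (c : ι → ℝ)
    {w : TangentSpace (𝓡 d) x} (hw : ∀ i, differential (G i) x w = 0) :
    -α.bilin x (correctedHam α G f c x) w =
      differential f x w - differential f x (reeb α x) * α x w := by
  have hG : ∀ i, α.bilin x (contactHam α (G i) x) w = 0 := fun i => by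
    rw [h.isContactAt.bilin_contactHam_of_differential_reeb_eq_zero hd (h.differential_reeb i),
      hw i, neg_zero]
  rw [← (h.isContactAt.contactHam_spec hd f).2 w]
  simp [correctedHam, hG]

theorem eq_zero_of_bilin_eq_zero (h : IsSecondClassAt α G x) (hd : Odd d)
    {v : TangentSpace (𝓡 d) x} (hv : ∀ i, differential (G i) x v = 0) (hαv : α x v = 0)
    (hBv : ∀ w, (∀ i, differential (G i) x w = 0) → α.bilin x v w = 0) : v = 0 := by
  refine h.isContactAt.eq_zero_of_iInf_ker (α.bilin_isAlt x)
    (D := fun i => (differential (G i) x).toLinearMap) (Y := fun i => contactHam α (G i) x)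
    (fun i => h.isContactAt.bilin_contactHam_of_differential_reeb_eq_zero hd
      (h.differential_reeb i)) ?_ hv hαv hBv
  have hdet := h.det_ne_zero
  rwa [bracketMatrix_eq_of_differential h.eq_zero] at hdet

theorem differential_correctedHam_sub (h : IsSecondClassAt α G x) (hd : Odd d) {f : M → ℝ}
    {c : ι → ℝ} (hc : ∀ i, differential (G i) x (correctedHam α G f c x) = 0) (g : M → ℝ) :
    differential g x (correctedHam α G f c x) - g x * differential f x (reeb α x) =
      jacobiBracket α f g x + ∑ i, ∑ j,
        jacobiBracket α (G i) g x * (bracketMatrix α G x)⁻¹ i j * jacobiBracket α (G j) f x := by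
  have hGg : ∀ i, jacobiBracket α (G i) g x = differential g x (contactHam α (G i) x) := fun i => by
    rw [jacobiBracket, h.differential_reeb, mul_zero, sub_zero]
  have hGf : ∀ j, jacobiBracket α (G j) f x = -differential (G j) x (contactHam α f x) :=
    fun j => h.isContactAt.jacobiBracket_eq_neg_differential hd f (h.eq_zero j)
  obtain rfl := (differential_correctedHam_eq_zero_iff h.eq_zero h.det_ne_zero f c).mp hc
  simp only [correctedHam, map_sub, map_sum, map_smul, smul_eq_mul, Matrix.mulVec, dotProduct,
    hGg, hGf, Finset.sum_mul, mul_neg, Finset.sum_neg_distrib]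
  rw [jacobiBracket, sub_right_comm, ← sub_eq_add_neg]
  exact congrArg _ (Finset.sum_congr rfl fun i _ => Finset.sum_congr rfl fun j _ => by ring)

theorem sum_jacobiBracket_eq_zero (h : IsSecondClassAt α G x) (hd : Odd d) {f g : M → ℝ}
    (hfg : (∀ i, differential (G i) x (contactHam α f x) = 0) ∨
      ∀ i, differential (G i) x (contactHam α g x) = 0) :
    ∑ i, ∑ j, jacobiBracket α (G i) g x * (bracketMatrix α G x)⁻¹ i j *
      jacobiBracket α (G j) f x = 0 := by
  refine Finset.sum_eq_zero fun i _ => Finset.sum_eq_zero fun j _ => ?_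
  rw [h.isContactAt.jacobiBracket_eq_neg_differential hd f (h.eq_zero j),
    h.isContactAt.jacobiBracket_eq_neg_differential hd g (h.eq_zero i)]
  rcases hfg with hf | hg
  · rw [hf j, neg_zero, mul_zero]
  · rw [hg i, neg_zero, zero_mul, zero_mul]

end IsSecondClassAt

section Immersion

variable {e : ℕ} {N : Type*} [TopologicalSpace N] [ChartedSpace (EuclideanSpace ℝ (Fin e)) N]
  {α : OneForm d M} {G : ι → M → ℝ} {j : N → M} {x : N}

/-- The map `j` is an immersion at `x`, the constraints `G i` are second class at `j x`, and the
image of the differential of `j` is the common kernel of theirs. The inclusion of the common zero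
set has this property, but nothing is asked of `j` away from `x`. -/
structure IsConstraintImmersionAt (α : OneForm d M) (G : ι → M → ℝ) (j : N → M) (x : N) :
    Prop where
  isSecondClassAt : IsSecondClassAt α G (j x)
  contMDiffAt : ContMDiffAt (𝓡 e) (𝓡 d) 2 j x
  injective : Function.Injective (mfderiv (𝓡 e) (𝓡 d) j x)
  mem_range_iff : ∀ v, v ∈ (mfderiv (𝓡 e) (𝓡 d) j x).range ↔ ∀ i, differential (G i) (j x) v = 0

theorem IsSecondClassAt.isConstraintImmersionAt_incl
    [ChartedSpace (EuclideanSpace ℝ (Fin e)) (zeroLocus G)] [IsManifold (𝓡 e) ∞ (zeroLocus G)]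
    {x : zeroLocus G} (h : IsSecondClassAt α G (x : M))
    (hG : ∀ i, MDifferentiableAt (𝓡 d) 𝓘(ℝ, ℝ) (G i) (x : M)) (he : Fintype.card ι + e = d)
    (hj : Manifold.IsImmersionAt (𝓡 e) (𝓡 d) ∞ (incl G) x) :
    IsConstraintImmersionAt (e := e) α G (incl G) x where
  isSecondClassAt := h
  contMDiffAt := hj.contMDiffAt.of_le (by decide)
  injective := mfderiv_injective_of_isImmersionAt (by simp) hj
  mem_range_iff := mem_range_mfderiv_incl_iff x hG h.det_ne_zero he hj

namespace IsConstraintImmersionAt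

theorem reeb_mem_range (h : IsConstraintImmersionAt (e := e) α G j x) :
    reeb α (j x) ∈ (mfderiv (𝓡 e) (𝓡 d) j x).range :=
  (h.mem_range_iff _).mpr h.isSecondClassAt.differential_reeb

variable [IsManifold (𝓡 d) ∞ M] [IsManifold (𝓡 e) ∞ N]

theorem isContactAt_pullback (h : IsConstraintImmersionAt (e := e) α G j x) (hα : α.IsSmooth)
    (hd : Odd d) : IsContactAt (d := e) (α.pullback j) x := by
  refine fun v hαv hBv => h.injective ((h.isSecondClassAt.eq_zero_of_bilin_eq_zero hd
    ((h.mem_range_iff _).mp ⟨v, rfl⟩) hαv fun w hw => ?_).trans (map_zero _).symm)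
  obtain ⟨u, rfl⟩ := (h.mem_range_iff w).mpr hw
  exact (OneForm.extDeriv_pullback (hα.differentiableAt_inChart _) h.contMDiffAt v u).symm.trans
    (hBv u)

theorem mfderiv_reeb_pullback (h : IsConstraintImmersionAt (e := e) α G j x) (hα : α.IsSmooth)
    (hd : Odd d) (he : Odd e) :
    mfderiv (𝓡 e) (𝓡 d) j x (reeb (α.pullback j) x) = reeb α (j x) :=
  ContactDirac.mfderiv_reeb_pullback hα h.contMDiffAt hd he h.isSecondClassAt.isContactAt
    (h.isContactAt_pullback hα hd) h.reeb_mem_range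

theorem mfderiv_contactHam_pullback (h : IsConstraintImmersionAt (e := e) α G j x)
    (hα : α.IsSmooth) (hd : Odd d) (he : Odd e) {f : M → ℝ}
    (hf : MDifferentiableAt (𝓡 d) 𝓘(ℝ, ℝ) f (j x)) {c : ι → ℝ}
    (hc : ∀ i, differential (G i) (j x) (correctedHam α G f c (j x)) = 0) :
    mfderiv (𝓡 e) (𝓡 d) j x (contactHam (α.pullback j) (f ∘ j) x) =
      correctedHam α G f c (j x) :=
  have h' := h.isSecondClassAt
  ContactDirac.mfderiv_contactHam_pullback hα h.contMDiffAt hd he h'.isContactAt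
    (h.isContactAt_pullback hα hd) h.reeb_mem_range hf ((h.mem_range_iff _).mpr hc)
    (h'.apply_correctedHam hd f c)
    fun w hw => h'.bilin_correctedHam hd f c ((h.mem_range_iff w).mp hw)

theorem jacobiBracket_pullback (h : IsConstraintImmersionAt (e := e) α G j x) (hα : α.IsSmooth)
    (hd : Odd d) (he : Odd e) {f g : M → ℝ} (hf : MDifferentiableAt (𝓡 d) 𝓘(ℝ, ℝ) f (j x))
    (hg : MDifferentiableAt (𝓡 d) 𝓘(ℝ, ℝ) g (j x)) :
    jacobiBracket (d := e) (α.pullback j) (f ∘ j) (g ∘ j) x =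
      jacobiBracket α f g (j x) + ∑ i, ∑ l, jacobiBracket α (G i) g (j x) *
        (bracketMatrix α G (j x))⁻¹ i l * jacobiBracket α (G l) f (j x) := by
  have h' := h.isSecondClassAt
  have hj := h.contMDiffAt.mdifferentiableAt two_ne_zero
  have hc := (differential_correctedHam_eq_zero_iff h'.eq_zero h'.det_ne_zero f _).mpr rfl
  rw [jacobiBracket, differential_comp hj hg, differential_comp hj hf,
    h.mfderiv_contactHam_pullback hα hd he hf hc, h.mfderiv_reeb_pullback hα hd he]
  exact h'.differential_correctedHam_sub hd hc g

theorem jacobiBracket_pullback_of_mem_range (h : IsConstraintImmersionAt (e := e) α G j x)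
    (hα : α.IsSmooth) (hd : Odd d) (he : Odd e) {f g : M → ℝ}
    (hf : MDifferentiableAt (𝓡 d) 𝓘(ℝ, ℝ) f (j x)) (hg : MDifferentiableAt (𝓡 d) 𝓘(ℝ, ℝ) g (j x))
    (hfg : contactHam α f (j x) ∈ (mfderiv (𝓡 e) (𝓡 d) j x).range ∨
      contactHam α g (j x) ∈ (mfderiv (𝓡 e) (𝓡 d) j x).range) :
    jacobiBracket (d := e) (α.pullback j) (f ∘ j) (g ∘ j) x = jacobiBracket α f g (j x) := by
  rw [h.jacobiBracket_pullback hα hd he hf hg,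
    h.isSecondClassAt.sum_jacobiBracket_eq_zero hd
      (hfg.imp (h.mem_range_iff _).mp (h.mem_range_iff _).mp), add_zero]

end IsConstraintImmersionAt

end Immersion

end SecondClass

end

end ContactDirac

theorem theorem3p1_general {n k : ℕ} {ι M : Type*} [Fintype ι] [DecidableEq ι]
    [TopologicalSpace M] [ChartedSpace (EuclideanSpace ℝ (Fin (2 * n + 1))) M]
    [IsManifold (𝓡 (2 * n + 1)) ∞ M]
    (α : OneForm (2 * n + 1) M) (hα : α.IsSmooth) (hι : Fintype.card ι = 2 * k)
    (G : ι → M → ℝ) (hG : ∀ j, IsSmoothFun (2 * n + 1) (G j))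
    (hC : ∀ x ∈ zeroLocus G, ∃ v, contactVolume α x v ≠ 0)
    (hReeb : ∀ x ∈ zeroLocus G, ∀ j, jacobiBracket α (fun _ => 1) (G j) x = 0)
    (hdet : ∀ x ∈ zeroLocus G, (bracketMatrix α G x).det ≠ 0) :
    ((zeroLocus G).Nonempty → k ≤ n) ∧
    (∃ _ : ChartedSpace (EuclideanSpace ℝ (Fin (2 * (n - k) + 1))) (zeroLocus G),
      IsManifold (𝓡 (2 * (n - k) + 1)) ∞ (zeroLocus G) ∧
      Manifold.IsSmoothEmbedding (𝓡 (2 * (n - k) + 1)) (𝓡 (2 * n + 1)) ∞ (incl G)) ∧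
    ∀ (_ : ChartedSpace (EuclideanSpace ℝ (Fin (2 * (n - k) + 1))) (zeroLocus G))
      (_ : IsManifold (𝓡 (2 * (n - k) + 1)) ∞ (zeroLocus G)),
      Manifold.IsSmoothEmbedding (𝓡 (2 * (n - k) + 1)) (𝓡 (2 * n + 1)) ∞ (incl G) →
      IsContactSubmanifold (m := n - k) α (incl G) ∧
      (∀ x : zeroLocus G,
        mfderiv (𝓡 (2 * (n - k) + 1)) (𝓡 (2 * n + 1)) (incl G) x
          (reeb (α.pullback (incl G)) x) = reeb α (x : M)) ∧
      ∀ f : M → ℝ, (∀ x ∈ zeroLocus G, MDifferentiableAt (𝓡 (2 * n + 1)) 𝓘(ℝ, ℝ) f x) →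
        (∃! c : ι → zeroLocus G → ℝ, IsMultiplier α G f c) ∧
        (∀ c : ι → zeroLocus G → ℝ, IsMultiplier α G f c → ∀ x : zeroLocus G,
          mfderiv (𝓡 (2 * (n - k) + 1)) (𝓡 (2 * n + 1)) (incl G) x
            (contactHam (α.pullback (incl G)) (f ∘ incl G) x) =
              correctedHam α G f (fun i => c i x) (x : M)) ∧
        ∀ g : M → ℝ, (∀ x ∈ zeroLocus G, MDifferentiableAt (𝓡 (2 * n + 1)) 𝓘(ℝ, ℝ) g x) →
          (∀ x : zeroLocus G,
            jacobiBracket (d := 2 * (n - k) + 1) (α.pullback (incl G))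
                (f ∘ incl G) (g ∘ incl G) x =
              jacobiBracket α f g (x : M) +
                ∑ i, ∑ j, jacobiBracket α (G i) g (x : M) * (bracketMatrix α G (x : M))⁻¹ i j *
                  jacobiBracket α (G j) f (x : M)) ∧
          (((∀ x : zeroLocus G, contactHam α f (x : M) ∈
                (mfderiv (𝓡 (2 * (n - k) + 1)) (𝓡 (2 * n + 1)) (incl G) x).range) ∨
              (∀ x : zeroLocus G, contactHam α g (x : M) ∈
                (mfderiv (𝓡 (2 * (n - k) + 1)) (𝓡 (2 * n + 1)) (incl G) x).range)) →
            ∀ x : zeroLocus G,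
              jacobiBracket (d := 2 * (n - k) + 1) (α.pullback (incl G))
                  (f ∘ incl G) (g ∘ incl G) x =
                jacobiBracket α f g (x : M)) := by
  have hd : Odd (2 * n + 1) := odd_two_mul_add_one n
  have he : Odd (2 * (n - k) + 1) := odd_two_mul_add_one _
  have hsecond : ∀ x ∈ zeroLocus G, IsSecondClassAt α G x := fun x hx =>
    have hCx := (isContactAt_iff_contactVolume α x).mpr (hC x hx)
    ⟨hCx, hx, fun i => (hCx.jacobiBracket_one hd (G i)).symm.trans (hReeb x hx i), hdet x hx⟩
  have hcard : (zeroLocus G).Nonempty → Fintype.card ι ≤ 2 * n + 1 := fun ⟨x, hx⟩ =>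
    card_le_of_det_bracketMatrix_ne_zero hx (hdet x hx)
  have hdim : (zeroLocus G).Nonempty → Fintype.card ι + (2 * (n - k) + 1) = 2 * n + 1 := by lia
  refine ⟨by lia, exists_isSmoothEmbedding_incl hG hdet hdim, fun _ _ hj => ?_⟩
  have himm : ∀ x : zeroLocus G,
      IsConstraintImmersionAt (e := 2 * (n - k) + 1) α G (incl G) x := fun x =>
    (hsecond x x.2).isConstraintImmersionAt_incl (fun i => (hG i).mdifferentiableAt (by simp))
      (hdim ⟨x, x.2⟩) (hj.isImmersion.isImmersionAt x)
  refine ⟨isContactSubmanifold_of_isContactAt hα hj hd (fun x => (hsecond x x.2).isContactAt)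
    (fun x => (himm x).isContactAt_pullback hα hd) (fun x => (himm x).reeb_mem_range),
    fun x => (himm x).mfderiv_reeb_pullback hα hd he, fun f hf => ⟨?_, ?_, fun g hg => ⟨?_, ?_⟩⟩⟩
  · exact existsUnique_isMultiplier hdet f
  · exact fun c hc x => (himm x).mfderiv_contactHam_pullback hα hd he (hf x x.2) (hc x)
  · exact fun x => (himm x).jacobiBracket_pullback hα hd he (hf x x.2) (hg x x.2)
  · exact fun hfg x => (himm x).jacobiBracket_pullback_of_mem_range hα hd he (hf x x.2) (hg x x.2)
      (hfg.imp (fun h => h x) fun h => h x)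

theorem theorem3p1 {n k : ℕ} {M : Type*} [TopologicalSpace M]
    [ChartedSpace (EuclideanSpace ℝ (Fin (2 * n + 1))) M] [IsManifold (𝓡 (2 * n + 1)) ∞ M]
    (α : OneForm (2 * n + 1) M) (hα : IsContactForm α)
    (G : Fin (2 * k) → M → ℝ) (hG : ∀ j, IsSmoothFun (2 * n + 1) (G j))
    (hReeb : ∀ x ∈ zeroLocus G, ∀ j, jacobiBracket α (fun _ => 1) (G j) x = 0)
    (hdet : ∀ x ∈ zeroLocus G, (bracketMatrix α G x).det ≠ 0) :
    -- `N = {G = 0}` is an embedded submanifold of dimension `2 (n - k) + 1`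
    ((zeroLocus G).Nonempty → k ≤ n) ∧
    (∃ _ : ChartedSpace (EuclideanSpace ℝ (Fin (2 * (n - k) + 1))) (zeroLocus G),
      IsManifold (𝓡 (2 * (n - k) + 1)) ∞ (zeroLocus G) ∧
      Manifold.IsSmoothEmbedding (𝓡 (2 * (n - k) + 1)) (𝓡 (2 * n + 1)) ∞ (incl G)) ∧
    -- for the submanifold structure of `N`:
    ∀ (_ : ChartedSpace (EuclideanSpace ℝ (Fin (2 * (n - k) + 1))) (zeroLocus G))
      (_ : IsManifold (𝓡 (2 * (n - k) + 1)) ∞ (zeroLocus G)),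
      Manifold.IsSmoothEmbedding (𝓡 (2 * (n - k) + 1)) (𝓡 (2 * n + 1)) ∞ (incl G) →
      -- (a)
      IsContactSubmanifold (m := n - k) α (incl G) ∧
      (∀ x : zeroLocus G,
        mfderiv (𝓡 (2 * (n - k) + 1)) (𝓡 (2 * n + 1)) (incl G) x
          (reeb (α.pullback (incl G)) x) = reeb α (x : M)) ∧
      -- (b)
      ∀ f : M → ℝ, IsSmoothFun (2 * n + 1) f →
        (∃! c : Fin (2 * k) → zeroLocus G → ℝ, IsMultiplier α G f c) ∧
        (∀ c : Fin (2 * k) → zeroLocus G → ℝ, IsMultiplier α G f c → ∀ x : zeroLocus G,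
          mfderiv (𝓡 (2 * (n - k) + 1)) (𝓡 (2 * n + 1)) (incl G) x
            (contactHam (α.pullback (incl G)) (f ∘ incl G) x) =
              correctedHam α G f (fun i => c i x) (x : M)) ∧
        ∀ g : M → ℝ, IsSmoothFun (2 * n + 1) g →
          (∀ x : zeroLocus G,
            jacobiBracket (d := 2 * (n - k) + 1) (α.pullback (incl G))
                (f ∘ incl G) (g ∘ incl G) x =
              jacobiBracket α f g (x : M) +
                ∑ i, ∑ j, jacobiBracket α (G i) g (x : M) * (bracketMatrix α G (x : M))⁻¹ i j *
                  jacobiBracket α (G j) f (x : M)) ∧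
          (((∀ x : zeroLocus G, contactHam α f (x : M) ∈
                (mfderiv (𝓡 (2 * (n - k) + 1)) (𝓡 (2 * n + 1)) (incl G) x).range) ∨
              (∀ x : zeroLocus G, contactHam α g (x : M) ∈
                (mfderiv (𝓡 (2 * (n - k) + 1)) (𝓡 (2 * n + 1)) (incl G) x).range)) →
            ∀ x : zeroLocus G,
              jacobiBracket (d := 2 * (n - k) + 1) (α.pullback (incl G))
                  (f ∘ incl G) (g ∘ incl G) x =
                jacobiBracket α f g (x : M)) := by
  have hsmooth {f : M → ℝ} (hf : IsSmoothFun (2 * n + 1) f) := fun x (_ : x ∈ zeroLocus G) =>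
    hf.mdifferentiableAt (x := x) (by simp)
  exact (theorem3p1_general α hα.1 (Fintype.card_fin _) G hG (fun x _ => hα.2 x) hReeb
    hdet).imp_right (.imp_right fun h _ _ hj => (h _ _ hj).imp_right (.imp_right fun h f hf =>
      (h f (hsmooth hf)).imp_right (.imp_right fun h g hg => h g (hsmooth hg))))
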